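/- Let $Z_1, Z_2, \ldots$ be independent, identically distributed random vectors in $\mathbb{R}^2$ with $\mathbb{E}\|Z_1\|^2 < \infty$ and $\mathbb{E} Z_1 \neq 0$. Let $S_0 = 0$ and $S_n = \sum_{i=1}^n Z_i$ for $n \ge 1$, and let $L_n$ be the perimeter length of the convex hull of $\{S_0, S_1, \ldots, S_n\}$, that is, the length of its boundary, where a hull that degenerates to a line segment has as perimeter twice the length of the segment (and a single point has perimeter $0$). Then each $L_n$ is a square-integrable random variable and, as $n \to \infty$, $$ n^{-1/2} \left| L_n - \mathbb{E} L_n - \sum_{i=1}^n \frac{2 (Z_i - \mathbb{E} Z_1) \cdot \mathbb{E} Z_1}{\|\mathbb{E} Z_1\|} \right| \longrightarrow 0 \quad \text{in } L^2 . $$ -/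

import Mathlib

open MeasureTheory ProbabilityTheory Filter Topology

/-- The Euclidean plane. -/
abbrev Plane : Type := EuclideanSpace ℝ (Fin 2)

/-- The walk `S_0 = 0`, `S_n = Z_1 + ⋯ + Z_n`. The sequence of increments is indexed from zero:
`Z i` is the increment `Z_{i+1}`. -/
noncomputable def walk {Ω : Type*} (Z : ℕ → Ω → Plane) (n : ℕ) (ω : Ω) : Plane :=
  ∑ i ∈ Finset.range n, Z i ω

/-- The convex hull of the positions `S_0, …, S_n`. -/
def walkHull {Ω : Type*} (Z : ℕ → Ω → Plane) (n : ℕ) (ω : Ω) : Set Plane :=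
  convexHull ℝ ((fun k => walk Z k ω) '' Set.Iic n)

open Classical in
/-- The perimeter length of a compact convex set `K` in the plane: the length (one-dimensional
Hausdorff measure) of its boundary. If `K` has no interior point, it is a line segment or a point
and its boundary curve runs along it twice, there and back, so that the perimeter is
twice the length of `K` (this is the convention in convex geometry, under which the perimeter is
continuous in `K`). -/
noncomputable def perimeter (K : Set Plane) : ℝ :=
  if (interior K).Nonempty then (Measure.hausdorffMeasure 1 (frontier K)).toReal
  else 2 * (Measure.hausdorffMeasure 1 K).toReal

/-- The perimeter length `L_n` of the convex hull of `S_0, …, S_n`. -/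
noncomputable def hullPerimeter {Ω : Type*} (Z : ℕ → Ω → Plane) (n : ℕ) (ω : Ω) : ℝ :=
  perimeter (walkHull Z n ω)

/-! Let `u` be the unit vector along the drift. By Cauchy's formula the perimeter is the integral,
over directions `dir u θ` with `θ` in `halfCircle`, of the width of the hull; for the walk this
width is max minus min of the projected positions (`spread`). When `cos θ > 0` the projected walk
drifts upwards, so its max should be near the final value and its min near 0. Writing the width as
final displacement plus a nonnegative `widthExcess`, and integrating the displacement exactly, gives
`L_n = D_n + 2 S_n · u` with `D_n` the integrated excess (`hullPerimeter_eq`). After centering, `2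
S_n · u` is precisely the sum in the theorem, so everything reduces to `‖D_n‖₂ = o(√n)`.

The excess is at most the sum of two reflected (Lindley) walks with increments `-Z_i · dir u θ`, one
in the given order and one in reversed order (`spread_sub_le_lindley`). With nonpositive drift their
second moments are at most linear in `n` (`integral_lindley_sq_le`); with negative drift they are
`o(n)` (`exists_integral_lindley_sq_le`), by truncation: the bounded part has bounded exponential
moments, the rest has small variance. Cauchy–Schwarz in the angle and dominated convergence over the
half circle then give the claim.

Cauchy's formula is proved for finite hulls by counting: the boundary lies on countably many lines,
and almost every line across the body meets it in exactly two points. -/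

/-- Rotation by a right angle. -/
noncomputable def perp (u : Plane) : Plane := !₂[-u 1, u 0]

/-- The direction at angle `θ` from `u`. -/
noncomputable def dir (u : Plane) (θ : ℝ) : Plane := Real.cos θ • u + Real.sin θ • perp u

/-! ### Coordinates and the frame `u`, `perp u` -/

@[simp] theorem perp_zero_coord (u : Plane) : perp u 0 = -u 1 := rfl
@[simp] theorem perp_one_coord (u : Plane) : perp u 1 = u 0 := rfl

theorem inner_plane (x y : Plane) : inner ℝ x y = x 0 * y 0 + x 1 * y 1 := by
  rw [PiLp.inner_apply, Fin.sum_univ_two]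
  simp [mul_comm]

theorem normSq_plane (x : Plane) : ‖x‖ ^ 2 = x 0 ^ 2 + x 1 ^ 2 := by
  rw [EuclideanSpace.norm_sq_eq, Fin.sum_univ_two]
  simp

theorem plane_ext {x y : Plane} (h0 : x 0 = y 0) (h1 : x 1 = y 1) : x = y := by
  ext i
  fin_cases i
  · exact h0
  · exact h1

theorem norm_perp (u : Plane) : ‖perp u‖ = ‖u‖ := by
  have h : ‖perp u‖ ^ 2 = ‖u‖ ^ 2 := by
    rw [normSq_plane, normSq_plane]
    simp
    ring
  exact (pow_left_inj₀ (norm_nonneg _) (norm_nonneg _) two_ne_zero).1 h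

theorem inner_self_perp (u : Plane) : inner ℝ u (perp u) = 0 := by
  rw [inner_plane]
  simp
  ring

theorem inner_perp_self (u : Plane) : inner ℝ (perp u) u = 0 := by
  rw [inner_plane]
  simp
  ring

/-- Expansion of a vector in the orthonormal basis `e`, `perp e`. -/
theorem expand_perp {e : Plane} (he : ‖e‖ = 1) (x : Plane) :
    x = (inner ℝ x e : ℝ) • e + (inner ℝ x (perp e) : ℝ) • perp e := by
  have h : e 0 ^ 2 + e 1 ^ 2 = 1 := by rw [← normSq_plane, he, one_pow]
  apply plane_ext
  · simp only [inner_plane, PiLp.add_apply, PiLp.smul_apply, smul_eq_mul, perp_zero_coord,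
      perp_one_coord]
    linear_combination (-x 0) * h
  · simp only [inner_plane, PiLp.add_apply, PiLp.smul_apply, smul_eq_mul, perp_zero_coord,
      perp_one_coord]
    linear_combination (-x 1) * h

theorem inner_sq_add_inner_perp_sq {e : Plane} (he : ‖e‖ = 1) (x : Plane) :
    (inner ℝ x e : ℝ) ^ 2 + (inner ℝ x (perp e) : ℝ) ^ 2 = ‖x‖ ^ 2 := by
  have h : e 0 ^ 2 + e 1 ^ 2 = 1 := by rw [← normSq_plane, he, one_pow]
  rw [normSq_plane]
  simp only [inner_plane, perp_zero_coord, perp_one_coord]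
  linear_combination (x 0 ^ 2 + x 1 ^ 2) * h

theorem inner_dir (x u : Plane) (θ : ℝ) :
    inner ℝ x (dir u θ) = Real.cos θ * inner ℝ x u + Real.sin θ * inner ℝ x (perp u) := by
  rw [dir, inner_add_right, real_inner_smul_right, real_inner_smul_right]

theorem norm_dir {u : Plane} (hu : ‖u‖ = 1) (θ : ℝ) : ‖dir u θ‖ = 1 := by
  have h : u 0 ^ 2 + u 1 ^ 2 = 1 := by rw [← normSq_plane, hu, one_pow]
  have h2 : ‖dir u θ‖ ^ 2 = 1 ^ 2 := by
    rw [normSq_plane]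
    simp only [dir, PiLp.add_apply, PiLp.smul_apply, smul_eq_mul, perp_zero_coord, perp_one_coord]
    linear_combination (Real.cos θ ^ 2 + Real.sin θ ^ 2) * h + Real.cos_sq_add_sin_sq θ
  exact (pow_left_inj₀ (norm_nonneg _) zero_le_one two_ne_zero).1 h2

theorem continuous_dir (u : Plane) : Continuous (dir u) := by
  unfold dir
  fun_prop

/-- Vectors orthogonal to a common nonzero vector of the plane are parallel. -/
theorem exists_smul_of_inner_eq_zero {a b e : Plane} (he : e ≠ 0) (ha0 : a ≠ 0)
    (ha : inner ℝ a e = (0 : ℝ)) (hb : inner ℝ b e = (0 : ℝ)) : ∃ r : ℝ, b = r • a := by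
  rw [inner_plane] at ha hb
  have hdet : a 0 * b 1 - a 1 * b 0 = 0 := by
    by_contra hne
    apply he
    apply plane_ext
    · have : (a 0 * b 1 - a 1 * b 0) * e 0 = 0 := by linear_combination b 1 * ha - a 1 * hb
      simpa [hne] using this
    · have : (a 0 * b 1 - a 1 * b 0) * e 1 = 0 := by linear_combination a 0 * hb - b 0 * ha
      simpa [hne] using this
  have hpos : a 0 ^ 2 + a 1 ^ 2 ≠ 0 := by
    rw [← normSq_plane]
    exact pow_ne_zero 2 (norm_ne_zero_iff.2 ha0)
  refine ⟨(a 0 * b 0 + a 1 * b 1) / (a 0 ^ 2 + a 1 ^ 2), plane_ext ?_ ?_⟩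
  · simp only [PiLp.smul_apply, smul_eq_mul]
    field_simp
    linear_combination (-a 1) * hdet
  · simp only [PiLp.smul_apply, smul_eq_mul]
    field_simp
    linear_combination (a 0) * hdet

/-! ### Directions and angles -/

/-- The angle `φ` is the argument of the complex number formed by the coordinates of `v` in the
frame `u`, `perp u`. -/
theorem exists_cos_sin {v u : Plane} (hv : ‖v‖ = 1) (hu : ‖u‖ = 1) :
    ∃ φ : ℝ, ∀ θ, inner ℝ v (dir u θ) = Real.cos (θ - φ) := by
  have h := inner_sq_add_inner_perp_sq hu v
  rw [hv, one_pow] at h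
  obtain ⟨φ, hc, hs⟩ : ∃ φ : ℝ, Real.cos φ = inner ℝ v u ∧ Real.sin φ = inner ℝ v (perp u) := by
    set z : ℂ := ⟨inner ℝ v u, inner ℝ v (perp u)⟩ with hz
    have hn : ‖z‖ = 1 := by
      have : ‖z‖ ^ 2 = 1 := by
        rw [← Complex.normSq_eq_norm_sq, Complex.normSq_apply]
        linear_combination h
      nlinarith [norm_nonneg z]
    have hz0 : z ≠ 0 := by
      rw [← norm_ne_zero_iff, hn]
      exact one_ne_zero
    refine ⟨z.arg, ?_, ?_⟩
    · rw [Complex.cos_arg hz0, hn, div_one]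
    · rw [Complex.sin_arg, hn, div_one]
  refine ⟨φ, fun θ => ?_⟩
  rw [inner_dir, Real.cos_sub, hc, hs]

/-- A shifted cosine has countably many zeros. Hence for almost every direction no boundary line is
collapsed to a point by the projection. -/
theorem ae_inner_dir_ne_zero {v u : Plane} (hv : ‖v‖ = 1) (hu : ‖u‖ = 1) :
    ∀ᵐ θ : ℝ, inner ℝ v (dir u θ) ≠ (0 : ℝ) := by
  obtain ⟨φ, hφ⟩ := exists_cos_sin hv hu
  rw [ae_iff]
  refine Set.Countable.measure_zero ?_ _
  refine (Set.countable_range (fun k : ℤ => (2 * (k : ℝ) + 1) * Real.pi / 2 + φ)).mono ?_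
  intro θ hθ
  simp only [ne_eq, not_not, Set.mem_ofPred_eq] at hθ
  rw [hφ, Real.cos_eq_zero_iff] at hθ
  obtain ⟨k, hk⟩ := hθ
  exact ⟨k, by simp only; linarith⟩

/-- The half circle of angles within a right angle of the reference direction. -/
abbrev halfCircle : Set ℝ := Set.Ioo (-(Real.pi / 2)) (Real.pi / 2)

/-- Since `|cos|` has period `π`, the integral over a half circle does not depend on the position of
`v`, and centring it gives the integral of `cos`. -/
theorem lintegral_abs_inner_dir {v u : Plane} (hv : ‖v‖ = 1) (hu : ‖u‖ = 1) :
    ∫⁻ θ in halfCircle, ENNReal.ofReal |inner ℝ v (dir u θ)| = 2 := by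
  obtain ⟨φ, hφ⟩ := exists_cos_sin hv hu
  simp_rw [hφ]
  have hper : Function.Periodic (fun θ : ℝ => |Real.cos θ|) Real.pi := by
    intro θ
    simp [Real.cos_add_pi]
  have hle : -(Real.pi / 2) ≤ Real.pi / 2 := by linarith [Real.pi_pos]
  have hc : Continuous (fun θ : ℝ => |Real.cos (θ - φ)|) := by fun_prop
  rw [← ofReal_integral_eq_lintegral_ofReal
      ((hc.integrableOn_Icc (a := -(Real.pi / 2)) (b := Real.pi / 2)).mono_set
        Set.Ioo_subset_Icc_self)
      (Eventually.of_forall fun _ => abs_nonneg _),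
    ← integral_Ioc_eq_integral_Ioo, ← intervalIntegral.integral_of_le hle,
    intervalIntegral.integral_comp_sub_right (fun x => |Real.cos x|) φ]
  have h1 := hper.intervalIntegral_add_eq (-(Real.pi / 2) - φ) (-(Real.pi / 2))
  have h2 : -(Real.pi / 2) - φ + Real.pi = Real.pi / 2 - φ := by ring
  have h3 : -(Real.pi / 2) + Real.pi = Real.pi / 2 := by ring
  rw [h2, h3] at h1
  rw [h1]
  have h4 : ∫ x in (-(Real.pi / 2))..(Real.pi / 2), |Real.cos x|
      = ∫ x in (-(Real.pi / 2))..(Real.pi / 2), Real.cos x := by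
    apply intervalIntegral.integral_congr
    intro x hx
    rw [Set.uIcc_of_le hle] at hx
    exact abs_of_nonneg (Real.cos_nonneg_of_mem_Icc hx)
  rw [h4, integral_cos, Real.sin_neg, Real.sin_pi_div_two]
  norm_num

/-! ### Subsets of lines -/

/-- The line through `p` with direction `v`. -/
def lineAt (p v : Plane) : Set Plane := Set.range fun s : ℝ => p + s • v

theorem isometry_line {v : Plane} (hv : ‖v‖ = 1) (p : Plane) :
    Isometry (fun s : ℝ => p + s • v) := by
  refine Isometry.of_dist_eq fun s t => ?_
  rw [dist_add_left, dist_eq_norm, ← sub_smul, norm_smul, hv, mul_one, Real.dist_eq,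
    Real.norm_eq_abs]

theorem measurableSet_lineAt {v : Plane} (hv : ‖v‖ = 1) (p : Plane) :
    MeasurableSet (lineAt p v) :=
  (isometry_line hv p).isClosedEmbedding.isClosed_range.measurableSet

/-- The length of the projection of a subset of a line. -/
theorem volume_image_inner_of_subset_line {v p : Plane} (hv : ‖v‖ = 1) {F : Set Plane}
    (hF : F ⊆ lineAt p v) (e : Plane) :
    volume ((fun x => inner ℝ x e) '' F)
      = ENNReal.ofReal |inner ℝ v e| * Measure.hausdorffMeasure 1 F := by
  obtain ⟨T, rfl⟩ := Set.subset_range_iff_exists_image_eq.1 hF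
  rw [(isometry_line hv p).hausdorffMeasure_image (Or.inl zero_le_one), hausdorffMeasure_real,
    Set.image_image]
  have h : (fun s : ℝ => (inner ℝ (p + s • v) e : ℝ)) '' T
      = (fun y : ℝ => inner ℝ p e + y) '' ((fun s : ℝ => (inner ℝ v e : ℝ) • s) '' T) := by
    rw [Set.image_image]
    refine Set.image_congr fun s _ => ?_
    rw [inner_add_left, real_inner_smul_left, smul_eq_mul, mul_comm]
  rw [h, Set.image_add_left, measure_preimage_add, Set.image_smul, Measure.addHaar_smul]
  simp

theorem injOn_inner_lineAt {v e : Plane} (hve : inner ℝ v e ≠ (0 : ℝ)) (p : Plane) :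
    Set.InjOn (fun x => (inner ℝ x e : ℝ)) (lineAt p v) := by
  rintro _ ⟨s, rfl⟩ _ ⟨t, rfl⟩ h
  simp only [inner_add_left, real_inner_smul_left] at h
  have : s = t := mul_right_cancel₀ hve (add_left_cancel h)
  rw [this]

/-! ### Slices of convex bodies -/

/-- A line through an interior point of a planar convex body meets its boundary in two points. -/
theorem frontier_inter_slice {K : Set Plane} (hK : IsCompact K) (hconv : Convex ℝ K)
    {e : Plane} (he : ‖e‖ = 1) {x₀ : Plane} (hx₀ : x₀ ∈ interior K) :
    ∃ a b : Plane, a ≠ b ∧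
      {x ∈ frontier K | (inner ℝ x e : ℝ) = inner ℝ x₀ e} = {a, b} := by
  have hpe : ‖perp e‖ = 1 := by rw [norm_perp, he]
  set g : ℝ → Plane := fun s => x₀ + s • perp e with hg
  have hgc : Continuous g := by fun_prop
  have hiso : Isometry g := isometry_line hpe x₀
  set I : Set ℝ := g ⁻¹' K with hI
  have hIc : IsCompact I := hiso.isClosedEmbedding.isCompact_preimage hK
  have h0 : (0 : ℝ) ∈ I := by
    simp only [hI, hg, Set.mem_preimage, zero_smul, add_zero]
    exact interior_subset hx₀
  have hne : I.Nonempty := ⟨0, h0⟩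
  have hnhds : I ∈ 𝓝 (0 : ℝ) := by
    apply hgc.continuousAt.preimage_mem_nhds
    simpa [hg] using mem_interior_iff_mem_nhds.1 hx₀
  obtain ⟨δ, hδ, hball⟩ := Metric.mem_nhds_iff.1 hnhds
  have hlow : -(δ / 2) ∈ I := hball (by simp [abs_of_pos hδ]; linarith)
  have hupp : δ / 2 ∈ I := hball (by simp [abs_of_pos hδ]; linarith)
  have hmin : sInf I ∈ I := hIc.sInf_mem hne
  have hmax : sSup I ∈ I := hIc.sSup_mem hne
  have hlt0 : sInf I < 0 := lt_of_le_of_lt (csInf_le hIc.bddBelow hlow) (by linarith)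
  have hgt0 : 0 < sSup I := lt_of_lt_of_le (by linarith) (le_csSup hIc.bddAbove hupp)
  -- Points strictly between the interior point `x₀` and a point of `K` are interior, so only the
  -- two ends of the chord can lie on the boundary.
  have hint : ∀ r ∈ I, ∀ c : ℝ, 0 < c → c ≤ 1 → g (r - c * r) ∈ interior K := by
    intro r hr c hc hc1
    rcases hc1.eq_or_lt with rfl | hc1
    · simpa [hg] using hx₀
    · apply hconv.openSegment_interior_self_subset_interior hx₀ hr
      refine ⟨c, 1 - c, hc, by linarith, by ring, ?_⟩
      simp only [hg]
      module
  have hfr : ∀ s, g s ∈ frontier K ↔ s = sInf I ∨ s = sSup I := by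
    intro s
    rw [hK.isClosed.frontier_eq]
    constructor
    · rintro ⟨hsK, hsn⟩
      have hs1 : sInf I ≤ s := csInf_le hIc.bddBelow hsK
      have hs2 : s ≤ sSup I := le_csSup hIc.bddAbove hsK
      by_contra hcon
      rw [not_or] at hcon
      apply hsn
      rcases le_total s 0 with hs | hs
      · have h := hint _ hmin (1 - s / sInf I)
          (by
            have : s / sInf I < 1 := by
              rw [div_lt_one_of_neg hlt0]
              exact lt_of_le_of_ne hs1 (Ne.symm hcon.1)
            linarith)
          (by
            have : 0 ≤ s / sInf I := div_nonneg_of_nonpos hs hlt0.le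
            linarith)
        have h2 : sInf I - (1 - s / sInf I) * sInf I = s := by
          field_simp [hlt0.ne]
          ring
        rwa [h2] at h
      · have h := hint _ hmax (1 - s / sSup I)
          (by
            have : s / sSup I < 1 := by
              rw [div_lt_one hgt0]
              exact lt_of_le_of_ne hs2 hcon.2
            linarith)
          (by
            have : 0 ≤ s / sSup I := div_nonneg hs hgt0.le
            linarith)
        have h2 : sSup I - (1 - s / sSup I) * sSup I = s := by
          field_simp [hgt0.ne']
          ring
        rwa [h2] at h
    · have hnot : ∀ r ∈ I, (∀ ε > 0, ∃ r', |r' - r| < ε ∧ r' ∉ I) → g r ∉ interior K := by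
        intro r _ hr hin
        have : I ∈ 𝓝 r := hgc.continuousAt.preimage_mem_nhds (mem_interior_iff_mem_nhds.1 hin)
        obtain ⟨ε, hε, hb⟩ := Metric.mem_nhds_iff.1 this
        obtain ⟨r', hr', hr'n⟩ := hr ε hε
        exact hr'n (hb (by rwa [Metric.mem_ball, Real.dist_eq]))
      rintro (rfl | rfl)
      · refine ⟨hmin, hnot _ hmin fun ε hε => ⟨sInf I - ε / 2, ?_, fun hmem => ?_⟩⟩
        · rw [abs_lt]
          constructor <;> linarith
        · linarith [csInf_le hIc.bddBelow hmem]
      · refine ⟨hmax, hnot _ hmax fun ε hε => ⟨sSup I + ε / 2, ?_, fun hmem => ?_⟩⟩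
        · rw [abs_lt]
          constructor <;> linarith
        · linarith [le_csSup hIc.bddAbove hmem]
  refine ⟨g (sInf I), g (sSup I), fun h => ?_, ?_⟩
  · have := hiso.injective h
    linarith
  · ext x
    constructor
    · rintro ⟨hxf, hxe⟩
      have hx : x = g (inner ℝ (x - x₀) (perp e)) := by
        have h := expand_perp he (x - x₀)
        rw [inner_sub_left x x₀ e, hxe, sub_self, zero_smul, zero_add] at h
        simp only [hg]
        rw [← h]
        abel
      rw [hx] at hxf
      rcases (hfr _).1 hxf with h | h
      · rw [h] at hx
        exact Or.inl hx
      · rw [h] at hx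
        exact Or.inr hx
    · have hval : ∀ s, (inner ℝ (g s) e : ℝ) = inner ℝ x₀ e := by
        intro s
        simp only [hg, inner_add_left, real_inner_smul_left, inner_perp_self, mul_zero, add_zero]
      rintro (rfl | rfl)
      · exact ⟨(hfr _).2 (Or.inl rfl), hval _⟩
      · exact ⟨(hfr _).2 (Or.inr rfl), hval _⟩

/-- Interior points of a projection of a convex body lift to interior points of the body. -/
theorem interior_image_inner_subset {K : Set Plane} (hconv : Convex ℝ K)
    (hint : (interior K).Nonempty) {e : Plane} {t : ℝ}
    (ht : t ∈ interior ((fun x => (inner ℝ x e : ℝ)) '' K)) :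
    ∃ x ∈ interior K, (inner ℝ x e : ℝ) = t := by
  obtain ⟨y, hy⟩ := hint
  obtain ⟨δ, hδ, hball⟩ := Metric.mem_nhds_iff.1 (mem_interior_iff_mem_nhds.1 ht)
  set d : ℝ := t - inner ℝ y e with hd
  -- Overshoot `t` slightly, away from the projection of `y`: a point `z` of `K` above `t + c * d`
  -- makes `t` the projection of a point strictly between `y` and `z`.
  obtain ⟨c, hc, hcd⟩ : ∃ c : ℝ, 0 < c ∧ c * |d| < δ := by
    refine ⟨δ / (2 * (|d| + 1)), by positivity, ?_⟩
    rw [div_mul_eq_mul_div, div_lt_iff₀ (by positivity)]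
    nlinarith [abs_nonneg d]
  obtain ⟨z, hzK, hz⟩ : t + c * d ∈ (fun x => (inner ℝ x e : ℝ)) '' K := by
    apply hball
    rw [Metric.mem_ball, Real.dist_eq]
    simpa [abs_mul, abs_of_pos hc] using hcd
  refine ⟨(c / (1 + c)) • y + (1 / (1 + c)) • z, ?_, ?_⟩
  · apply hconv.openSegment_interior_self_subset_interior hy hzK
    exact ⟨c / (1 + c), 1 / (1 + c), by positivity, by positivity, by field_simp; ring, rfl⟩
  · simp only at hz
    rw [inner_add_left, real_inner_smul_left, real_inner_smul_left, hz]
    field_simp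
    rw [hd]
    ring

/-! ### Cauchy's formula -/

theorem convex_image_inner {K : Set Plane} (hconv : Convex ℝ K) (e : Plane) :
    Convex ℝ ((fun x => (inner ℝ x e : ℝ)) '' K) :=
  hconv.is_linear_image
    ⟨fun x y => inner_add_left x y e, fun c x => real_inner_smul_left x e c⟩

/-- Almost every value in the projection is taken at exactly two boundary points. They lie in
different pieces because the projection is injective on each line, and disjointing the lines
prevents a vertex from being counted twice. Integrating the count over `t` gives the factor 2. -/
theorem tsum_volume_image_disjointed {K : Set Plane} (hK : IsCompact K) (hconv : Convex ℝ K)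
    (hint : (interior K).Nonempty) {p v : ℕ → Plane} (hv : ∀ j, ‖v j‖ = 1)
    (hcov : frontier K ⊆ ⋃ j, lineAt (p j) (v j)) {e : Plane} (he : ‖e‖ = 1)
    (hve : ∀ j, inner ℝ (v j) e ≠ (0 : ℝ)) :
    ∑' j, volume ((fun x => (inner ℝ x e : ℝ)) ''
        (frontier K ∩ disjointed (fun j => lineAt (p j) (v j)) j))
      = 2 * volume ((fun x => (inner ℝ x e : ℝ)) '' K) := by
  set π : Plane → ℝ := fun x => inner ℝ x e with hπ
  have hπc : Continuous π := by fun_prop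
  set F : ℕ → Set Plane := fun j => frontier K ∩ disjointed (fun j => lineAt (p j) (v j)) j with hF
  have hFline : ∀ j, F j ⊆ lineAt (p j) (v j) := fun j =>
    Set.inter_subset_right.trans (disjointed_subset _ j)
  have hFmeas : ∀ j, MeasurableSet (F j) := fun j =>
    isClosed_frontier.measurableSet.inter
      (MeasurableSet.disjointed (fun i => measurableSet_lineAt (hv i) (p i)) j)
  have hFinj : ∀ j, Set.InjOn π (F j) := fun j =>
    (injOn_inner_lineAt (hve j) (p j)).mono (hFline j)
  have himeas : ∀ j, MeasurableSet (π '' F j) := fun j =>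
    (hFmeas j).image_of_continuousOn_injOn hπc.continuousOn (hFinj j)
  have hKm : MeasurableSet (π '' K) := (hK.image hπc).isClosed.measurableSet
  have hdisj : Pairwise (Function.onFun Disjoint F) := by
    intro i j hij
    exact ((disjoint_disjointed (fun j => lineAt (p j) (v j)) hij).mono
      Set.inter_subset_right Set.inter_subset_right)
  have hFK : frontier K ⊆ ⋃ j, F j := by
    rw [hF, ← Set.inter_iUnion, iUnion_disjointed]
    exact Set.subset_inter subset_rfl hcov
  have hcount : ∀ᵐ t : ℝ, ∑' j, (π '' F j).indicator (1 : ℝ → ENNReal) t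
      = 2 * (π '' K).indicator (1 : ℝ → ENNReal) t := by
    -- The endpoints of the projection, over which the count may differ from two, form a null set.
    have hnull : ∀ᵐ t : ℝ, t ∉ frontier (π '' K) :=
      measure_eq_zero_iff_ae_notMem.1 ((convex_image_inner hconv e).addHaar_frontier volume)
    filter_upwards [hnull] with t ht
    by_cases htK : t ∈ π '' K
    · have hti : t ∈ interior (π '' K) := by
        by_contra hcon
        exact ht ⟨subset_closure htK, hcon⟩
      obtain ⟨x₀, hx₀, rfl⟩ := interior_image_inner_subset hconv hint hti
      obtain ⟨a, b, hab, hset⟩ := frontier_inter_slice hK hconv he hx₀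
      have ha : a ∈ {x ∈ frontier K | (inner ℝ x e : ℝ) = inner ℝ x₀ e} := by
        rw [hset]
        exact Set.mem_insert _ _
      have hb : b ∈ {x ∈ frontier K | (inner ℝ x e : ℝ) = inner ℝ x₀ e} := by
        rw [hset]
        exact Set.mem_insert_of_mem _ rfl
      obtain ⟨i, hi⟩ := Set.mem_iUnion.1 (hFK ha.1)
      obtain ⟨j, hj⟩ := Set.mem_iUnion.1 (hFK hb.1)
      have hij : i ≠ j := by
        rintro rfl
        exact hab (hFinj i hi hj (ha.2.trans hb.2.symm))
      have hmi : π x₀ ∈ π '' F i := ⟨a, hi, ha.2⟩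
      have hmj : π x₀ ∈ π '' F j := ⟨b, hj, hb.2⟩
      have hother : ∀ k ∉ ({i, j} : Finset ℕ),
          (π '' F k).indicator (1 : ℝ → ENNReal) (π x₀) = 0 := by
        intro k hk
        apply Set.indicator_of_notMem
        rintro ⟨y, hy, hyx⟩
        simp only [Finset.mem_insert, Finset.mem_singleton, not_or] at hk
        have hys : y ∈ ({a, b} : Set Plane) := by
          rw [← hset]
          exact ⟨hy.1, hyx⟩
        rcases hys with rfl | hyb
        · exact Set.disjoint_left.1 (hdisj hk.1) hy hi
        · rw [Set.mem_singleton_iff] at hyb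
          subst hyb
          exact Set.disjoint_left.1 (hdisj hk.2) hy hj
      rw [tsum_eq_sum hother, Finset.sum_pair hij, Set.indicator_of_mem hmi,
        Set.indicator_of_mem hmj, Set.indicator_of_mem htK]
      simp only [Pi.one_apply, mul_one]
      norm_num
    · rw [Set.indicator_of_notMem htK, mul_zero, ENNReal.tsum_eq_zero]
      intro j
      apply Set.indicator_of_notMem
      rintro ⟨y, hy, rfl⟩
      exact htK ⟨y, hK.isClosed.frontier_subset hy.1, rfl⟩
  calc ∑' j, volume (π '' F j) = ∑' j, ∫⁻ t, (π '' F j).indicator (1 : ℝ → ENNReal) t := by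
        simp_rw [lintegral_indicator_one (himeas _)]
    _ = ∫⁻ t, ∑' j, (π '' F j).indicator (1 : ℝ → ENNReal) t :=
        (lintegral_tsum fun j => (measurable_one.indicator (himeas j)).aemeasurable).symm
    _ = ∫⁻ t, 2 * (π '' K).indicator (1 : ℝ → ENNReal) t := lintegral_congr_ae hcount
    _ = 2 * volume (π '' K) := by
        rw [lintegral_const_mul _ (measurable_one.indicator hKm), lintegral_indicator_one hKm]

theorem measurable_ofReal_abs_inner_dir (v u : Plane) :
    Measurable fun θ => ENNReal.ofReal |inner ℝ v (dir u θ)| := by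
  have := continuous_dir u
  exact ENNReal.measurable_ofReal.comp
    (by fun_prop : Continuous fun θ => |(inner ℝ v (dir u θ) : ℝ)|).measurable

/-- Cauchy's formula for a convex body whose boundary is covered by countably many lines. -/
theorem hausdorffMeasure_frontier {K : Set Plane} (hK : IsCompact K) (hconv : Convex ℝ K)
    (hint : (interior K).Nonempty) {p v : ℕ → Plane} (hv : ∀ j, ‖v j‖ = 1)
    (hcov : frontier K ⊆ ⋃ j, lineAt (p j) (v j)) {u : Plane} (hu : ‖u‖ = 1) :
    Measure.hausdorffMeasure 1 (frontier K)
      = ∫⁻ θ in halfCircle, volume ((fun x => (inner ℝ x (dir u θ) : ℝ)) '' K) := by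
  set F : ℕ → Set Plane := fun j => frontier K ∩ disjointed (fun j => lineAt (p j) (v j)) j with hF
  have hFline : ∀ j, F j ⊆ lineAt (p j) (v j) := fun j =>
    Set.inter_subset_right.trans (disjointed_subset _ j)
  have hFmeas : ∀ j, MeasurableSet (F j) := fun j =>
    isClosed_frontier.measurableSet.inter
      (MeasurableSet.disjointed (fun i => measurableSet_lineAt (hv i) (p i)) j)
  have hdisj : Pairwise (Function.onFun Disjoint F) := by
    intro i j hij
    exact ((disjoint_disjointed (fun j => lineAt (p j) (v j)) hij).mono
      Set.inter_subset_right Set.inter_subset_right)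
  have hFK : frontier K = ⋃ j, F j := by
    rw [hF, ← Set.inter_iUnion, iUnion_disjointed, Set.inter_eq_left.2 hcov]
  have hsum : Measure.hausdorffMeasure 1 (frontier K) = ∑' j, Measure.hausdorffMeasure 1 (F j) := by
    conv_lhs => rw [hFK]
    exact measure_iUnion hdisj hFmeas
  have hae : ∀ᵐ θ : ℝ, ∀ j, inner ℝ (v j) (dir u θ) ≠ (0 : ℝ) :=
    ae_all_iff.2 fun j => ae_inner_dir_ne_zero (hv j) hu
  -- The 2 on the left is the integral of `|cos|` over the half circle; the 2 on the right is the
  -- two-fold covering of the projection by the boundary.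
  have hmul : 2 * Measure.hausdorffMeasure 1 (frontier K)
      = 2 * ∫⁻ θ in halfCircle, volume ((fun x => (inner ℝ x (dir u θ) : ℝ)) '' K) := by
    calc 2 * Measure.hausdorffMeasure 1 (frontier K)
        = ∑' j, ∫⁻ θ in halfCircle,
            ENNReal.ofReal |inner ℝ (v j) (dir u θ)| * Measure.hausdorffMeasure 1 (F j) := by
          rw [hsum, ← ENNReal.tsum_mul_left]
          refine tsum_congr fun j => ?_
          rw [lintegral_mul_const _ (measurable_ofReal_abs_inner_dir _ _),
            lintegral_abs_inner_dir (hv j) hu]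
      _ = ∫⁻ θ in halfCircle, ∑' j,
            ENNReal.ofReal |inner ℝ (v j) (dir u θ)| * Measure.hausdorffMeasure 1 (F j) :=
          (lintegral_tsum fun j =>
            ((measurable_ofReal_abs_inner_dir _ _).mul_const _).aemeasurable).symm
      _ = ∫⁻ θ in halfCircle, 2 * volume ((fun x => (inner ℝ x (dir u θ) : ℝ)) '' K) := by
          refine lintegral_congr_ae (ae_restrict_of_ae ?_)
          filter_upwards [hae] with θ hθ
          rw [← tsum_volume_image_disjointed hK hconv hint hv hcov (norm_dir hu θ) hθ]
          refine tsum_congr fun j => ?_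
          exact (volume_image_inner_of_subset_line (hv j) (hFline j) _).symm
      _ = _ := lintegral_const_mul' _ _ ENNReal.ofNat_ne_top
  exact (ENNReal.mul_right_inj two_ne_zero ENNReal.ofNat_ne_top).1 hmul

/-- Cauchy's formula for a subset of a line. -/
theorem two_mul_hausdorffMeasure_of_subset_line {K : Set Plane} {p v u : Plane} (hv : ‖v‖ = 1)
    (hK : K ⊆ lineAt p v) (hu : ‖u‖ = 1) :
    2 * Measure.hausdorffMeasure 1 K
      = ∫⁻ θ in halfCircle, volume ((fun x => (inner ℝ x (dir u θ) : ℝ)) '' K) := by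
  simp_rw [volume_image_inner_of_subset_line hv hK]
  rw [lintegral_mul_const _ (measurable_ofReal_abs_inner_dir _ _), lintegral_abs_inner_dir hv hu]

/-! ### Convex hulls of finite sets -/

/-- A unit vector along `x` (an arbitrary one if `x = 0`). -/
theorem exists_unit_smul (x : Plane) : ∃ v : Plane, ‖v‖ = 1 ∧ x = ‖x‖ • v := by
  by_cases hx : x = 0
  · exact ⟨EuclideanSpace.single 0 1, by simp, by simp [hx]⟩
  · have : ‖x‖ ≠ 0 := norm_ne_zero_iff.2 hx
    exact ⟨‖x‖⁻¹ • x, by rw [norm_smul, norm_inv, norm_norm, inv_mul_cancel₀ this],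
      by rw [smul_smul, mul_inv_cancel₀ this, one_smul]⟩

/-- Take a supporting line at a boundary point `x`. Every point of `s` with nonzero weight in a
convex combination giving `x` lies on that line, so `x` is either such a point or on the line
through two of them. -/
theorem frontier_convexHull_subset_lines {s : Finset Plane} (hs : s.Nonempty)
    (hint : (interior (convexHull ℝ (s : Set Plane))).Nonempty) :
    ∃ p v : ℕ → Plane, (∀ j, ‖v j‖ = 1) ∧
      frontier (convexHull ℝ (s : Set Plane)) ⊆ ⋃ j, lineAt (p j) (v j) := by
  have : Nonempty (s × s) := by
    obtain ⟨x, hx⟩ := hs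
    exact ⟨(⟨x, hx⟩, ⟨x, hx⟩)⟩
  obtain ⟨f, hf⟩ := exists_surjective_nat (s × s)
  choose w hw1 hw2 using exists_unit_smul
  -- Degenerate pairs `(a, a)` are kept, with an arbitrary direction: they cover the boundary points
  -- that are themselves in `s`.
  refine ⟨fun j => (f j).1, fun j => w ((f j).2 - (f j).1), fun j => hw1 _, ?_⟩
  set K := convexHull ℝ (s : Set Plane) with hK
  have hconv : Convex ℝ K := convex_convexHull ℝ _
  intro x hx
  suffices h : ∃ a ∈ s, ∃ b ∈ s, ∃ r : ℝ, x - a = r • (b - a) by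
    obtain ⟨a, ha, b, hb, r, hr⟩ := h
    obtain ⟨j, hj⟩ := hf (⟨a, ha⟩, ⟨b, hb⟩)
    refine Set.mem_iUnion.2 ⟨j, r * ‖b - a‖, ?_⟩
    simp only [hj]
    rw [← smul_smul, ← hw2, ← hr]
    abel
  obtain ⟨l, hl⟩ := geometric_hahn_banach_open_point hconv.interior isOpen_interior hx.2
  obtain ⟨y₀, hy₀⟩ := hint
  set e : Plane := (InnerProductSpace.toDual ℝ Plane).symm l with he
  have hle : ∀ y, l y = inner ℝ y e := by
    intro y
    rw [real_inner_comm, he, InnerProductSpace.toDual_symm_apply]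
  have he0 : e ≠ 0 := by
    intro h0
    have := hl y₀ hy₀
    rw [hle, hle, h0, inner_zero_right, inner_zero_right] at this
    exact lt_irrefl _ this
  have hKle : ∀ y ∈ K, (inner ℝ y e : ℝ) ≤ inner ℝ x e := by
    intro y hy
    have hy' : y ∈ closure (interior K) := by
      rw [hconv.closure_interior_eq_closure_of_nonempty_interior ⟨y₀, hy₀⟩]
      exact subset_closure hy
    have hcl : closure (interior K) ⊆ {z | (inner ℝ z e : ℝ) ≤ inner ℝ x e} := by
      apply closure_minimal
      · intro z hz
        have := (hl z hz).le
        rwa [hle, hle] at this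
      · exact isClosed_le (by fun_prop) continuous_const
    exact hcl hy'
  have hxK : x ∈ K := by
    have hc : IsCompact K := s.finite_toSet.isCompact_convexHull (𝕜 := ℝ)
    exact hc.isClosed.frontier_subset hx
  obtain ⟨c, hc0, hc1, hcx⟩ := Finset.mem_convexHull'.1 hxK
  -- A weighted average of nonnegative gaps vanishes, so each gap with nonzero weight vanishes.
  have hface : ∀ a ∈ s, c a ≠ 0 → (inner ℝ (a - x) e : ℝ) = 0 := by
    have hsum : ∑ a ∈ s, c a * (inner ℝ x e - inner ℝ a e : ℝ) = 0 := by
      have h1 : (inner ℝ x e : ℝ) = ∑ a ∈ s, c a * inner ℝ a e := by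
        conv_lhs => rw [← hcx]
        rw [sum_inner]
        exact Finset.sum_congr rfl fun a _ => real_inner_smul_left _ _ _
      simp_rw [mul_sub]
      rw [Finset.sum_sub_distrib, ← Finset.sum_mul, hc1, one_mul, ← h1, sub_self]
    have hnn : ∀ a ∈ s, 0 ≤ c a * (inner ℝ x e - inner ℝ a e : ℝ) := fun a ha =>
      mul_nonneg (hc0 a ha) (sub_nonneg.2 (hKle a (subset_convexHull ℝ _ ha)))
    intro a ha hca
    have := (Finset.sum_eq_zero_iff_of_nonneg hnn).1 hsum a ha
    rw [mul_eq_zero] at this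
    rw [inner_sub_left]
    rcases this with h | h
    · exact absurd h hca
    · linarith
  obtain ⟨a, ha, hca⟩ : ∃ a ∈ s, c a ≠ 0 := by
    by_contra! hcon
    rw [Finset.sum_eq_zero hcon] at hc1
    exact zero_ne_one hc1
  by_cases hall : ∀ b ∈ s, c b ≠ 0 → b = a
  · refine ⟨a, ha, a, ha, 0, ?_⟩
    rw [zero_smul, sub_eq_zero]
    calc x = ∑ b ∈ s, c b • b := hcx.symm
      _ = ∑ b ∈ s, c b • a := by
          refine Finset.sum_congr rfl fun b hb => ?_
          by_cases hcb : c b = 0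
          · rw [hcb, zero_smul, zero_smul]
          · rw [hall b hb hcb]
      _ = a := by rw [← Finset.sum_smul, hc1, one_smul]
  · push Not at hall
    obtain ⟨b, hb, hcb, hba⟩ := hall
    obtain ⟨r, hr⟩ := exists_smul_of_inner_eq_zero (a := b - a) (b := x - a) he0 (sub_ne_zero.2 hba)
      (by
        have h1 := hface b hb hcb
        have h2 := hface a ha hca
        rw [inner_sub_left] at h1 h2 ⊢
        linarith)
      (by
        have h2 := hface a ha hca
        rw [inner_sub_left] at h2 ⊢
        linarith)
    exact ⟨a, ha, b, hb, r, hr⟩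

/-- Without interior, the affine span is a proper subspace of the plane, so the points are
collinear. -/
theorem convexHull_subset_line_of_interior_eq_empty {s : Set Plane}
    (hint : ¬ (interior (convexHull ℝ s)).Nonempty) :
    ∃ p v : Plane, ‖v‖ = 1 ∧ convexHull ℝ s ⊆ lineAt p v := by
  have hcol : Collinear ℝ s := by
    rcases s.eq_empty_or_nonempty with rfl | hne
    · exact collinear_empty ℝ _
    rw [interior_convexHull_nonempty_iff_affineSpan_eq_top] at hint
    rw [collinear_iff_finrank_le_one]
    have hlt : vectorSpan ℝ s ≠ ⊤ := fun h =>
      hint ((AffineSubspace.affineSpan_eq_top_iff_vectorSpan_eq_top_of_nonempty ℝ Plane Plane hne).2 h)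
    have := Submodule.finrank_lt hlt
    rw [finrank_euclideanSpace_fin] at this
    omega
  obtain ⟨p, w, hw⟩ := (collinear_iff_exists_forall_eq_smul_vadd s).1 hcol
  obtain ⟨v, hv, hwv⟩ := exists_unit_smul w
  refine ⟨p, v, hv, convexHull_min ?_ ?_⟩
  · intro x hx
    obtain ⟨r, hr⟩ := hw x hx
    refine ⟨r * ‖w‖, ?_⟩
    simp only
    rw [← smul_smul, ← hwv, hr, vadd_eq_add, add_comm]
  · rintro _ ⟨a, rfl⟩ _ ⟨b, rfl⟩ α β _ _ hαβ
    refine ⟨α * a + β * b, ?_⟩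
    obtain rfl : β = 1 - α := by linarith
    simp only
    module

/-- Cauchy's formula: the perimeter is the integral of the widths. -/
theorem perimeter_convexHull {s : Set Plane} (hs : s.Finite) (hne : s.Nonempty)
    {u : Plane} (hu : ‖u‖ = 1) :
    perimeter (convexHull ℝ s) = (∫⁻ θ in halfCircle,
      volume ((fun x => (inner ℝ x (dir u θ) : ℝ)) '' convexHull ℝ s)).toReal := by
  unfold perimeter
  split_ifs with hint
  · lift s to Finset Plane using hs
    obtain ⟨p, v, hv, hcov⟩ := frontier_convexHull_subset_lines hne hint
    rw [hausdorffMeasure_frontier (s.finite_toSet.isCompact_convexHull (𝕜 := ℝ))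
      (convex_convexHull ℝ _) hint hv hcov hu]
  · obtain ⟨p, v, hv, hK⟩ := convexHull_subset_line_of_interior_eq_empty hint
    rw [← two_mul_hausdorffMeasure_of_subset_line hv hK hu, ENNReal.toReal_mul, ENNReal.toReal_ofNat]

theorem convexHull_image_Iic (x : ℕ → ℝ) (n : ℕ) :
    convexHull ℝ (x '' Set.Iic n)
      = Set.Icc ((Finset.range (n + 1)).inf' Finset.nonempty_range_add_one x)
          ((Finset.range (n + 1)).sup' Finset.nonempty_range_add_one x) := by
  apply Set.Subset.antisymm
  · apply convexHull_min _ (convex_Icc _ _)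
    rintro _ ⟨k, hk, rfl⟩
    have hk' : k ∈ Finset.range (n + 1) := Finset.mem_range.2 (Nat.lt_succ_of_le hk)
    exact ⟨Finset.inf'_le _ hk', Finset.le_sup' _ hk'⟩
  · obtain ⟨i, hi, hie⟩ := Finset.exists_mem_eq_inf' (Finset.nonempty_range_add_one (n := n)) x
    obtain ⟨j, hj, hje⟩ := Finset.exists_mem_eq_sup' (Finset.nonempty_range_add_one (n := n)) x
    have hle : x i ≤ x j := by
      rw [← hie]
      exact Finset.inf'_le _ hj
    rw [hie, hje, ← segment_eq_Icc hle]
    apply (convex_convexHull ℝ _).segment_subset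
    · exact subset_convexHull ℝ _ ⟨i, Nat.lt_succ_iff.1 (Finset.mem_range.1 hi), rfl⟩
    · exact subset_convexHull ℝ _ ⟨j, Nat.lt_succ_iff.1 (Finset.mem_range.1 hj), rfl⟩

/-- The width of the first `n + 1` terms of a sequence. -/
noncomputable def spread (x : ℕ → ℝ) (n : ℕ) : ℝ :=
  (Finset.range (n + 1)).sup' Finset.nonempty_range_add_one x
    - (Finset.range (n + 1)).inf' Finset.nonempty_range_add_one x

theorem perimeter_convexHull_image (q : ℕ → Plane) (n : ℕ) {u : Plane} (hu : ‖u‖ = 1) :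
    perimeter (convexHull ℝ (q '' Set.Iic n))
      = (∫⁻ θ in halfCircle, ENNReal.ofReal (spread (fun k => inner ℝ (q k) (dir u θ)) n)).toReal := by
  rw [perimeter_convexHull ((Set.finite_Iic n).image q) (Set.nonempty_Iic.image q) hu]
  congr 1
  refine lintegral_congr fun θ => ?_
  have hlin : IsLinearMap ℝ fun x : Plane => (inner ℝ x (dir u θ) : ℝ) :=
    ⟨fun x y => inner_add_left x y _, fun c x => real_inner_smul_left x _ c⟩
  rw [hlin.image_convexHull, Set.image_image, convexHull_image_Iic, Real.volume_Icc, spread]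

/-! ### Lindley's recursion -/

/-- The walk with increments `x`, reflected at zero. -/
noncomputable def lindley (x : ℕ → ℝ) : ℕ → ℝ
  | 0 => 0
  | n + 1 => max 0 (lindley x n + x n)

theorem lindley_nonneg (x : ℕ → ℝ) (n : ℕ) : 0 ≤ lindley x n := by
  cases n with
  | zero => exact le_rfl
  | succ n => exact le_max_left _ _

theorem lindley_succ_sq_le (x : ℕ → ℝ) (n : ℕ) :
    lindley x (n + 1) ^ 2 ≤ (lindley x n + x n) ^ 2 := by
  rw [lindley]
  rcases le_total 0 (lindley x n + x n) with h | h
  · rw [max_eq_right h]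
  · rw [max_eq_left h, zero_pow two_ne_zero]
    exact sq_nonneg _

/-- Unrolled, the recursion is the maximum of all tail sums ending at `n`; only this inequality is
needed. -/
theorem sum_Ico_le_lindley (x : ℕ → ℝ) {n k : ℕ} (hk : k ≤ n) :
    ∑ i ∈ Finset.Ico k n, x i ≤ lindley x n := by
  induction n with
  | zero => simp [lindley]
  | succ n ih =>
    rcases hk.eq_or_lt with rfl | h
    · rw [Finset.Ico_self, Finset.sum_empty]
      exact lindley_nonneg _ _
    · have hkn : k ≤ n := Nat.lt_succ_iff.1 h
      rw [Finset.sum_Ico_succ_top hkn, lindley]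
      exact (add_le_add_left (ih hkn) _).trans (le_max_right _ _)

theorem lindley_congr {x y : ℕ → ℝ} {n : ℕ} (h : ∀ i < n, x i = y i) :
    lindley x n = lindley y n := by
  induction n with
  | zero => rfl
  | succ n ih =>
    rw [lindley, lindley, ih fun i hi => h i (hi.trans n.lt_succ_self), h n n.lt_succ_self]

/-- Allows a truncated part and its remainder to be estimated separately. -/
theorem lindley_add_le (x y : ℕ → ℝ) (n : ℕ) :
    lindley (fun i => x i + y i) n ≤ lindley x n + lindley y n := by
  induction n with
  | zero => simp [lindley]
  | succ n ih =>
    rw [lindley, lindley, lindley]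
    apply max_le
    · exact add_nonneg (le_max_left _ _) (le_max_left _ _)
    · have h1 := le_max_right 0 (lindley x n + x n)
      have h2 := le_max_right 0 (lindley y n + y n)
      linarith

theorem lindley_le_mul {x : ℕ → ℝ} {B : ℝ} (hB : 0 ≤ B) (hx : ∀ i, |x i| ≤ B) (n : ℕ) :
    lindley x n ≤ n * B := by
  induction n with
  | zero => simp [lindley]
  | succ n ih =>
    rw [lindley]
    apply max_le (by positivity)
    have := (abs_le.1 (hx n)).2
    push_cast
    linarith

theorem measurable_lindley {α : Type*} [MeasurableSpace α] {ξ : ℕ → α → ℝ}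
    (hξ : ∀ i, Measurable (ξ i)) (n : ℕ) : Measurable fun a => lindley (fun i => ξ i a) n := by
  induction n with
  | zero => exact measurable_const
  | succ n ih => exact measurable_const.max (ih.add (hξ n))

/-- Clipping to `[-B, B]`. -/
noncomputable def clip (B x : ℝ) : ℝ := max (-B) (min x B)

theorem measurable_clip (B : ℝ) : Measurable (clip B) := by
  unfold clip
  fun_prop

theorem abs_clip_le {B : ℝ} (hB : 0 ≤ B) (x : ℝ) : |clip B x| ≤ B := by
  rw [clip, abs_le]
  exact ⟨le_max_left _ _, max_le (by linarith) (min_le_right _ _)⟩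

theorem clip_eq_self {B x : ℝ} (h : |x| ≤ B) : clip B x = x := by
  rw [abs_le] at h
  rw [clip, min_eq_left h.2, max_eq_right h.1]

theorem abs_sub_clip_le {B : ℝ} (hB : 0 ≤ B) (x : ℝ) : |x - clip B x| ≤ |x| := by
  rcases le_total x (-B) with h | h
  · rw [clip, min_eq_left (by linarith), max_eq_left h, abs_of_nonpos (by linarith),
      abs_of_nonpos (by linarith)]
    linarith
  · rcases le_total x B with h' | h'
    · rw [clip_eq_self (abs_le.2 ⟨h, h'⟩), sub_self, abs_zero]
      exact abs_nonneg _
    · rw [clip, min_eq_right h', max_eq_right (by linarith), abs_of_nonneg (by linarith),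
        abs_of_nonneg (by linarith)]
      linarith

/-! ### Moments of the reflected walk -/

section Independent

variable {Ω : Type*} [MeasurableSpace Ω] {P : Measure Ω} {ξ : ℕ → Ω → ℝ}

/-- The reflected walk at time `n` uses only the increments with index below `n`. -/
theorem indepFun_lindley (hm : ∀ i, Measurable (ξ i)) (hind : iIndepFun ξ P) (n : ℕ) :
    IndepFun (fun ω => lindley (fun i => ξ i ω) n) (ξ n) P := by
  have h := hind.indepFun_finset (Finset.range n) {n}
    (Finset.disjoint_singleton_right.2 Finset.notMem_range_self) hm
  -- The default 0 outside the range is never read, by `lindley_congr`.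
  let φ : ((i : Finset.range n) → ℝ) → ℝ := fun t =>
    lindley (fun i => if hi : i ∈ Finset.range n then t ⟨i, hi⟩ else 0) n
  let ψ : ((i : ({n} : Finset ℕ)) → ℝ) → ℝ := fun t => t ⟨n, Finset.mem_singleton_self n⟩
  have hφ : Measurable φ := by
    apply measurable_lindley
    intro i
    by_cases hi : i ∈ Finset.range n
    · simp only [hi, dite_true]
      exact measurable_pi_apply _
    · simp only [hi, dite_false]
      exact measurable_const
  have hψ : Measurable ψ := measurable_pi_apply _
  have hcomp := h.comp hφ hψ
  have h1 : (φ ∘ fun a (i : Finset.range n) => ξ i a) = fun ω => lindley (fun i => ξ i ω) n := by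
    funext ω
    refine lindley_congr fun i hi => ?_
    simp [Finset.mem_range.2 hi]
  rw [h1] at hcomp
  exact hcomp

theorem memLp_lindley (hm : ∀ i, Measurable (ξ i)) (hL : ∀ i, MemLp (ξ i) 2 P) (n : ℕ) :
    MemLp (fun ω => lindley (fun i => ξ i ω) n) 2 P := by
  induction n with
  | zero => exact MemLp.zero
  | succ n ih =>
    refine (ih.add (hL n)).of_le (measurable_lindley hm _).aestronglyMeasurable
      (Eventually.of_forall fun ω => ?_)
    simp only [Pi.add_apply, Real.norm_eq_abs]
    exact sq_le_sq.1 (lindley_succ_sq_le _ _)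

theorem exists_integral_sub_clip_sq_le {T : Ω → ℝ} (hT : Measurable T) (hL : MemLp T 2 P) {ε : ℝ}
    (hε : 0 < ε) : ∃ B : ℝ, 0 < B ∧ ∫ ω, (T ω - clip B (T ω)) ^ 2 ∂P ≤ ε := by
  have hlim : Tendsto (fun k : ℕ => ∫ ω, (T ω - clip (k : ℝ) (T ω)) ^ 2 ∂P) atTop (𝓝 0) := by
    have h := tendsto_integral_of_dominated_convergence (μ := P)
      (F := fun (k : ℕ) ω => (T ω - clip (k : ℝ) (T ω)) ^ 2) (f := fun _ => (0 : ℝ))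
      (fun ω => T ω ^ 2)
      (fun k => ((hT.sub ((measurable_clip _).comp hT)).pow_const 2).aestronglyMeasurable)
      hL.integrable_sq
      (fun k => Eventually.of_forall fun ω => by
        rw [Real.norm_eq_abs, abs_of_nonneg (sq_nonneg _)]
        exact sq_le_sq.2 (abs_sub_clip_le k.cast_nonneg _))
      (Eventually.of_forall fun ω => by
        apply tendsto_const_nhds.congr'
        filter_upwards [eventually_ge_atTop ⌈|T ω|⌉₊] with k hk
        rw [clip_eq_self (Nat.ceil_le.1 hk), sub_self, zero_pow two_ne_zero])
    simpa using h
  obtain ⟨k, hk, hk1⟩ := ((hlim.eventually_le_const hε).and (eventually_ge_atTop 1)).exists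
  exact ⟨k, by exact_mod_cast hk1, hk⟩

/-- In the expansion of `(W_n + ξ_n)²` the cross term has nonpositive mean, because `W_n ≥ 0` is
independent of `ξ_n`. Each step therefore adds at most `σ`. -/
theorem integral_lindley_sq_le (hm : ∀ i, Measurable (ξ i)) (hind : iIndepFun ξ P)
    (hL : ∀ i, MemLp (ξ i) 2 P) (hmean : ∀ i, ∫ ω, ξ i ω ∂P ≤ 0) {σ : ℝ}
    (hσ : ∀ i, ∫ ω, ξ i ω ^ 2 ∂P ≤ σ) (n : ℕ) :
    ∫ ω, lindley (fun i => ξ i ω) n ^ 2 ∂P ≤ n * σ := by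
  induction n with
  | zero => simp [lindley]
  | succ n ih =>
    have hW := memLp_lindley hm hL n
    have hW1 := memLp_lindley hm hL (n + 1)
    have hprod : Integrable (fun ω => lindley (fun i => ξ i ω) n * ξ n ω) P :=
      hW.integrable_mul (hL n)
    have hzero : ∫ ω, lindley (fun i => ξ i ω) n * ξ n ω ∂P ≤ 0 := by
      rw [(indepFun_lindley hm hind n).integral_fun_mul_eq_mul_integral
        hW.aestronglyMeasurable (hL n).aestronglyMeasurable]
      exact mul_nonpos_of_nonneg_of_nonpos (integral_nonneg fun ω => lindley_nonneg _ _) (hmean n)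
    calc ∫ ω, lindley (fun i => ξ i ω) (n + 1) ^ 2 ∂P
        ≤ ∫ ω, (lindley (fun i => ξ i ω) n ^ 2
            + (2 * (lindley (fun i => ξ i ω) n * ξ n ω) + ξ n ω ^ 2)) ∂P := by
          refine integral_mono hW1.integrable_sq
            (hW.integrable_sq.add ((hprod.const_mul 2).add (hL n).integrable_sq)) fun ω => ?_
          have := lindley_succ_sq_le (fun i => ξ i ω) n
          simp only
          linarith [add_sq (lindley (fun i => ξ i ω) n) (ξ n ω)]
      _ = ∫ ω, lindley (fun i => ξ i ω) n ^ 2 ∂P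
            + (2 * ∫ ω, lindley (fun i => ξ i ω) n * ξ n ω ∂P + ∫ ω, ξ n ω ^ 2 ∂P) := by
          rw [← integral_const_mul, ← integral_add (hprod.const_mul 2) (hL n).integrable_sq]
          exact integral_add hW.integrable_sq ((hprod.const_mul 2).add (hL n).integrable_sq)
      _ ≤ n * σ + σ := by linarith [hσ n]
      _ = (n + 1 : ℕ) * σ := by push_cast; ring

variable [IsProbabilityMeasure P]

/-- Bounded increments with mean below `-m`: the second moments stay bounded. -/
theorem exists_integral_lindley_sq_le_of_bounded {B m : ℝ} (hB : 0 < B) (hmpos : 0 < m) :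
    ∃ C : ℝ, ∀ ξ : ℕ → Ω → ℝ, (∀ i, Measurable (ξ i)) → iIndepFun ξ P →
      (∀ i ω, |ξ i ω| ≤ B) → (∀ i, ∫ ω, ξ i ω ∂P ≤ -m) →
      ∀ n, ∫ ω, lindley (fun i => ξ i ω) n ^ 2 ∂P ≤ C := by
  -- Small enough that `|l ξ| ≤ 1`, so that `exp x ≤ 1 + x + x²` applies, and that the quadratic
  -- term costs at most half of the drift `l * m`.
  set l : ℝ := min (1 / B) (m / (2 * B ^ 2)) with hl
  have hlpos : 0 < l := lt_min (by positivity) (by positivity)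
  have hlB : l * B ≤ 1 := by
    have := mul_le_mul_of_nonneg_right (min_le_left (1 / B) (m / (2 * B ^ 2))) hB.le
    rwa [one_div_mul_cancel hB.ne'] at this
  have hlB2 : l * B ^ 2 ≤ m / 2 := by
    have := mul_le_mul_of_nonneg_right (min_le_right (1 / B) (m / (2 * B ^ 2))) (sq_nonneg B)
    have h2 : m / (2 * B ^ 2) * B ^ 2 = m / 2 := by field_simp
    rwa [h2] at this
  -- The map `x ↦ 1 + x (1 - l m / 2)` has fixed point `2 / (l m)`; adding 1 keeps the bound stable
  -- under it and above the initial value 1.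
  set A : ℝ := 1 + 2 / (l * m) with hA
  refine ⟨2 / l ^ 2 * A, fun ξ hm hind hb hmean n => ?_⟩
  have hWm := measurable_lindley hm
  have hWb : ∀ k ω, lindley (fun i => ξ i ω) k ≤ k * B := fun k ω =>
    lindley_le_mul hB.le (fun i => hb i ω) k
  have hexpint : ∀ k, Integrable (fun ω => Real.exp (l * lindley (fun i => ξ i ω) k)) P := by
    intro k
    refine Integrable.of_bound
      (Real.measurable_exp.comp ((hWm k).const_mul l)).aestronglyMeasurable
      (Real.exp (l * (k * B))) (Eventually.of_forall fun ω => ?_)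
    rw [Real.norm_eq_abs, Real.abs_exp]
    exact Real.exp_le_exp.2 (mul_le_mul_of_nonneg_left (hWb k ω) hlpos.le)
  have hξint : ∀ i, Integrable (ξ i) P := fun i =>
    Integrable.of_bound (hm i).aestronglyMeasurable B (Eventually.of_forall fun ω => hb i ω)
  have hξexpint : ∀ i, Integrable (fun ω => Real.exp (l * ξ i ω)) P := by
    intro i
    refine Integrable.of_bound
      (Real.measurable_exp.comp ((hm i).const_mul l)).aestronglyMeasurable
      (Real.exp (l * B)) (Eventually.of_forall fun ω => ?_)
    rw [Real.norm_eq_abs, Real.abs_exp]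
    exact Real.exp_le_exp.2 (mul_le_mul_of_nonneg_left (abs_le.1 (hb i ω)).2 hlpos.le)
  have hρ : ∀ i, ∫ ω, Real.exp (l * ξ i ω) ∂P ≤ 1 - l * m / 2 := by
    intro i
    have hpt : ∀ ω, Real.exp (l * ξ i ω) ≤ (1 + l * m / 2) + l * ξ i ω := by
      intro ω
      have habs : |l * ξ i ω| ≤ 1 := by
        rw [abs_mul, abs_of_pos hlpos]
        exact (mul_le_mul_of_nonneg_left (hb i ω) hlpos.le).trans hlB
      have h1 := (abs_le.1 (Real.abs_exp_sub_one_sub_id_le habs)).2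
      have h2 : ξ i ω ^ 2 ≤ B ^ 2 := sq_le_sq' (abs_le.1 (hb i ω)).1 (abs_le.1 (hb i ω)).2
      have h3 : (l * ξ i ω) ^ 2 ≤ l * m / 2 := by
        have : l * (l * ξ i ω ^ 2) ≤ l * (l * B ^ 2) := by gcongr
        nlinarith
      linarith
    have hmono := integral_mono (hξexpint i)
      ((integrable_const (1 + l * m / 2)).add ((hξint i).const_mul l)) hpt
    have heq : ∫ ω, ((1 + l * m / 2) + l * ξ i ω) ∂P = (1 + l * m / 2) + l * ∫ ω, ξ i ω ∂P := by
      rw [integral_add (integrable_const _) ((hξint i).const_mul l), integral_const_mul]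
      simp
    have h4 : ∫ ω, Real.exp (l * ξ i ω) ∂P ≤ (1 + l * m / 2) + l * ∫ ω, ξ i ω ∂P := by
      rw [← heq]
      exact hmono
    nlinarith [hmean i]
  have hexp : ∀ k, ∫ ω, Real.exp (l * lindley (fun i => ξ i ω) k) ∂P ≤ A := by
    intro k
    induction k with
    | zero =>
      simp only [lindley, mul_zero, Real.exp_zero, integral_const, probReal_univ, one_smul, hA]
      linarith [show 0 < 2 / (l * m) by positivity]
    | succ k ih =>
      have hindk : IndepFun (fun ω => Real.exp (l * lindley (fun i => ξ i ω) k))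
          (fun ω => Real.exp (l * ξ k ω)) P :=
        (indepFun_lindley hm hind k).comp (φ := fun y => Real.exp (l * y))
          (ψ := fun y => Real.exp (l * y)) (by fun_prop) (by fun_prop)
      have hprod : Integrable (fun ω => Real.exp (l * lindley (fun i => ξ i ω) k)
          * Real.exp (l * ξ k ω)) P := hindk.integrable_mul (hexpint k) (hξexpint k)
      -- Reflection at zero costs at most an additive 1, as `exp (max 0 y) ≤ 1 + exp y`.
      have hpt : ∀ ω, Real.exp (l * lindley (fun i => ξ i ω) (k + 1))
          ≤ 1 + Real.exp (l * lindley (fun i => ξ i ω) k) * Real.exp (l * ξ k ω) := by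
        intro ω
        rw [← Real.exp_add, ← mul_add, lindley]
        rcases le_total 0 (lindley (fun i => ξ i ω) k + ξ k ω) with h | h
        · rw [max_eq_right h]
          linarith
        · rw [max_eq_left h, mul_zero, Real.exp_zero]
          linarith [Real.exp_pos (l * (lindley (fun i => ξ i ω) k + ξ k ω))]
      have hmono := integral_mono (hexpint (k + 1)) ((integrable_const (1 : ℝ)).add hprod) hpt
      have heq : ∫ ω, (1 + Real.exp (l * lindley (fun i => ξ i ω) k) * Real.exp (l * ξ k ω)) ∂P
          = 1 + (∫ ω, Real.exp (l * lindley (fun i => ξ i ω) k) ∂P)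
            * ∫ ω, Real.exp (l * ξ k ω) ∂P := by
        rw [integral_add (integrable_const _) hprod, hindk.integral_fun_mul_eq_mul_integral
          (hexpint k).aestronglyMeasurable (hξexpint k).aestronglyMeasurable]
        simp
      have hE0 : 0 ≤ ∫ ω, Real.exp (l * ξ k ω) ∂P := integral_nonneg fun ω => (Real.exp_pos _).le
      have hA0 : 0 ≤ A := by positivity
      calc ∫ ω, Real.exp (l * lindley (fun i => ξ i ω) (k + 1)) ∂P
          ≤ 1 + (∫ ω, Real.exp (l * lindley (fun i => ξ i ω) k) ∂P)
            * ∫ ω, Real.exp (l * ξ k ω) ∂P := by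
            rw [← heq]
            exact hmono
        _ ≤ 1 + A * (1 - l * m / 2) := by
            gcongr
            exact hρ k
        _ ≤ A := by
            have : A * (l * m / 2) = l * m / 2 + 1 := by
              rw [hA]
              field_simp
            nlinarith [mul_pos hlpos hmpos]
  have hsq : ∀ ω, lindley (fun i => ξ i ω) n ^ 2
      ≤ 2 / l ^ 2 * Real.exp (l * lindley (fun i => ξ i ω) n) := by
    intro ω
    have h0 : 0 ≤ l * lindley (fun i => ξ i ω) n := mul_nonneg hlpos.le (lindley_nonneg _ _)
    have h1 := Real.quadratic_le_exp_of_nonneg h0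
    rw [div_mul_eq_mul_div, le_div_iff₀ (by positivity)]
    nlinarith
  have hL : ∀ i, MemLp (ξ i) 2 P := fun i =>
    MemLp.of_bound (hm i).aestronglyMeasurable B (Eventually.of_forall fun ω => hb i ω)
  calc ∫ ω, lindley (fun i => ξ i ω) n ^ 2 ∂P
      ≤ ∫ ω, 2 / l ^ 2 * Real.exp (l * lindley (fun i => ξ i ω) n) ∂P :=
        integral_mono (memLp_lindley hm hL n).integrable_sq ((hexpint n).const_mul _) hsq
    _ = 2 / l ^ 2 * ∫ ω, Real.exp (l * lindley (fun i => ξ i ω) n) ∂P := integral_const_mul _ _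
    _ ≤ 2 / l ^ 2 * A := by
        gcongr
        exact hexp n

/-- The second moments of a reflected walk with negative drift grow sublinearly, with bounds that
depend only on the law of the increments. -/
theorem exists_integral_lindley_sq_le {T : Ω → ℝ} (hT : Measurable T) (hTL : MemLp T 2 P)
    (hmean : ∫ ω, T ω ∂P < 0) {ε : ℝ} (hε : 0 < ε) :
    ∃ C : ℝ, ∀ ξ : ℕ → Ω → ℝ, (∀ i, Measurable (ξ i)) → iIndepFun ξ P →
      (∀ i, IdentDistrib (ξ i) T P P) →
      ∀ n : ℕ, ∫ ω, lindley (fun i => ξ i ω) n ^ 2 ∂P ≤ C + n * ε := by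
  -- Half of `ε` offsets the factor in `(a + b)² ≤ 2a² + 2b²`.
  obtain ⟨B, hB, hBε⟩ := exists_integral_sub_clip_sq_le hT hTL (half_pos hε)
  -- Moving the mean `c` of the clipped-off part into the bounded part centres the remainder and
  -- leaves the bounded part with the full negative drift.
  set c : ℝ := ∫ ω, (T ω - clip B (T ω)) ∂P with hc
  obtain ⟨C, hC⟩ := exists_integral_lindley_sq_le_of_bounded (P := P)
    (B := B + |c|) (m := -∫ ω, T ω ∂P) (by positivity) (by linarith)
  have hTint : Integrable T P := hTL.integrable one_le_two
  have hclip : Integrable (fun ω => clip B (T ω)) P :=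
    Integrable.of_bound ((measurable_clip B).comp hT).aestronglyMeasurable B
      (Eventually.of_forall fun ω => abs_clip_le hB.le _)
  refine ⟨2 * C, fun ξ hm hind hid n => ?_⟩
  have hg1 : Measurable fun x => clip B x + c := (measurable_clip B).add_const c
  have hg2 : Measurable fun x => x - clip B x - c :=
    (measurable_id.sub (measurable_clip B)).sub_const c
  set ξ₁ : ℕ → Ω → ℝ := fun i ω => clip B (ξ i ω) + c with hξ₁
  set ξ₂ : ℕ → Ω → ℝ := fun i ω => ξ i ω - clip B (ξ i ω) - c with hξ₂
  have hm1 : ∀ i, Measurable (ξ₁ i) := fun i => hg1.comp (hm i)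
  have hm2 : ∀ i, Measurable (ξ₂ i) := fun i => hg2.comp (hm i)
  have hind1 : iIndepFun ξ₁ P := hind.comp (fun _ x => clip B x + c) fun _ => hg1
  have hind2 : iIndepFun ξ₂ P := hind.comp (fun _ x => x - clip B x - c) fun _ => hg2
  have hb1 : ∀ i ω, |ξ₁ i ω| ≤ B + |c| := fun i ω =>
    (abs_add_le _ _).trans (add_le_add_left (abs_clip_le hB.le _) _)
  have hmean1 : ∀ i, ∫ ω, ξ₁ i ω ∂P ≤ - -∫ ω, T ω ∂P := by
    intro i
    have h1 : ∫ ω, ξ₁ i ω ∂P = ∫ ω, (clip B (T ω) + c) ∂P := ((hid i).comp hg1).integral_eq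
    rw [h1, integral_add hclip (integrable_const _), hc, integral_sub hTint hclip]
    simp
  have hL : ∀ i, MemLp (ξ i) 2 P := fun i => (hid i).symm.memLp_snd hTL
  have hL1 : ∀ i, MemLp (ξ₁ i) 2 P := fun i =>
    MemLp.of_bound (hm1 i).aestronglyMeasurable _ (Eventually.of_forall fun ω => hb1 i ω)
  have hL2 : ∀ i, MemLp (ξ₂ i) 2 P := by
    intro i
    have h : ξ₂ i = ξ i - ξ₁ i := by
      funext ω
      simp only [hξ₂, hξ₁, Pi.sub_apply]
      ring
    rw [h]
    exact (hL i).sub (hL1 i)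
  have hmean2 : ∀ i, ∫ ω, ξ₂ i ω ∂P ≤ 0 := by
    intro i
    have h1 : ∫ ω, ξ₂ i ω ∂P = ∫ ω, (T ω - clip B (T ω) - c) ∂P := ((hid i).comp hg2).integral_eq
    have h2 : ∫ ω, (T ω - clip B (T ω) - c) ∂P = c - ∫ _, c ∂P :=
      integral_sub (hTint.sub hclip) (integrable_const _)
    rw [h1, h2]
    simp
  have hvar2 : ∀ i, ∫ ω, ξ₂ i ω ^ 2 ∂P ≤ ε / 2 := by
    intro i
    have h1 : ∫ ω, ξ₂ i ω ^ 2 ∂P = ∫ ω, (T ω - clip B (T ω) - c) ^ 2 ∂P :=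
      ((hid i).comp (hg2.pow_const 2)).integral_eq
    have hY : Measurable fun ω => T ω - clip B (T ω) := hT.sub ((measurable_clip B).comp hT)
    have h2 : ∫ ω, (T ω - clip B (T ω) - c) ^ 2 ∂P
        = variance (fun ω => T ω - clip B (T ω)) P := by
      rw [variance_eq_integral hY.aemeasurable]
    rw [h1, h2]
    exact (variance_le_expectation_sq hY.aestronglyMeasurable).trans hBε
  have hW1 := hC ξ₁ hm1 hind1 hb1 hmean1 n
  have hW2 := integral_lindley_sq_le hm2 hind2 hL2 hmean2 hvar2 n
  have hI1 := (memLp_lindley hm1 hL1 n).integrable_sq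
  have hI2 := (memLp_lindley hm2 hL2 n).integrable_sq
  have hpt : ∀ ω, lindley (fun i => ξ i ω) n ^ 2
      ≤ 2 * lindley (fun i => ξ₁ i ω) n ^ 2 + 2 * lindley (fun i => ξ₂ i ω) n ^ 2 := by
    intro ω
    have h1 : (fun i => ξ i ω) = fun i => ξ₁ i ω + ξ₂ i ω := by
      funext i
      simp only [hξ₁, hξ₂]
      ring
    have h2 : lindley (fun i => ξ i ω) n
        ≤ lindley (fun i => ξ₁ i ω) n + lindley (fun i => ξ₂ i ω) n := by
      rw [h1]
      exact lindley_add_le _ _ n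
    nlinarith [lindley_nonneg (fun i => ξ i ω) n, pow_le_pow_left₀ (lindley_nonneg _ _) h2 2,
      sq_nonneg (lindley (fun i => ξ₁ i ω) n - lindley (fun i => ξ₂ i ω) n)]
  have hmono := integral_mono (memLp_lindley hm hL n).integrable_sq
    ((hI1.const_mul 2).add (hI2.const_mul 2)) hpt
  have heq : ∫ ω, (2 * lindley (fun i => ξ₁ i ω) n ^ 2 + 2 * lindley (fun i => ξ₂ i ω) n ^ 2) ∂P
      = 2 * ∫ ω, lindley (fun i => ξ₁ i ω) n ^ 2 ∂P
        + 2 * ∫ ω, lindley (fun i => ξ₂ i ω) n ^ 2 ∂P := by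
    rw [integral_add (hI1.const_mul 2) (hI2.const_mul 2), integral_const_mul, integral_const_mul]
  calc ∫ ω, lindley (fun i => ξ i ω) n ^ 2 ∂P
      ≤ 2 * ∫ ω, lindley (fun i => ξ₁ i ω) n ^ 2 ∂P
        + 2 * ∫ ω, lindley (fun i => ξ₂ i ω) n ^ 2 ∂P := by
        rw [← heq]
        exact hmono
    _ ≤ 2 * C + n * ε := by linarith

end Independent

/-! ### Widths of walks -/

/-- The permutation reversing the first `n` indices. -/
def reverseBelow (n i : ℕ) : ℕ := if i < n then n - 1 - i else i

theorem reverseBelow_injective (n : ℕ) : Function.Injective (reverseBelow n) := by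
  intro i j h
  unfold reverseBelow at h
  split_ifs at h <;> omega

/-- Reversal turns initial sums into tail sums, which the reflected walk controls. Fixing the
indices from `n` on keeps `reverseBelow n` injective on `ℕ`, so independence survives reindexing. -/
theorem sum_range_eq_sum_reverseBelow (x : ℕ → ℝ) {n k : ℕ} (hk : k ≤ n) :
    ∑ i ∈ Finset.range k, x i = ∑ i ∈ Finset.Ico (n - k) n, x (reverseBelow n i) := by
  refine Finset.sum_nbij' (fun i => n - 1 - i) (fun i => n - 1 - i) ?_ ?_ ?_ ?_ ?_
  · intro i hi
    rw [Finset.mem_range] at hi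
    rw [Finset.mem_Ico]
    omega
  · intro i hi
    rw [Finset.mem_Ico] at hi
    rw [Finset.mem_range]
    omega
  · intro i hi
    rw [Finset.mem_range] at hi
    omega
  · intro i hi
    rw [Finset.mem_Ico] at hi
    omega
  · intro i hi
    rw [Finset.mem_range] at hi
    have : reverseBelow n (n - 1 - i) = i := by
      unfold reverseBelow
      split_ifs <;> omega
    rw [this]

/-- With `s` the walk with increments `-x`, `max s - s n` is a tail sum of `x`, and `-min s` is an
initial sum of `x`, that is, a tail sum of the reversed sequence. -/
theorem spread_sub_le_lindley (x : ℕ → ℝ) (n : ℕ) :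
    spread (fun k => ∑ i ∈ Finset.range k, -x i) n - ∑ i ∈ Finset.range n, -x i
      ≤ lindley x n + lindley (fun i => x (reverseBelow n i)) n := by
  set s : ℕ → ℝ := fun k => ∑ i ∈ Finset.range k, -x i with hs
  obtain ⟨k, hk, hke⟩ := Finset.exists_mem_eq_sup' (Finset.nonempty_range_add_one (n := n)) s
  obtain ⟨j, hj, hje⟩ := Finset.exists_mem_eq_inf' (Finset.nonempty_range_add_one (n := n)) s
  have hkn : k ≤ n := Nat.lt_succ_iff.1 (Finset.mem_range.1 hk)
  have hjn : j ≤ n := Nat.lt_succ_iff.1 (Finset.mem_range.1 hj)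
  have h1 : s k - s n ≤ lindley x n := by
    refine le_trans (le_of_eq ?_) (sum_Ico_le_lindley x hkn)
    have := Finset.sum_range_add_sum_Ico (fun i => -x i) hkn
    simp only [hs]
    rw [← this]
    simp
  have h2 : -s j ≤ lindley (fun i => x (reverseBelow n i)) n := by
    refine le_trans (le_of_eq ?_) (sum_Ico_le_lindley _ (Nat.sub_le n j))
    rw [← sum_range_eq_sum_reverseBelow x hjn]
    simp [hs]
  rw [spread, hke, hje]
  linarith

theorem le_spread {s : ℕ → ℝ} (h0 : s 0 = 0) (n : ℕ) : s n ≤ spread s n := by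
  have h1 : s n ≤ (Finset.range (n + 1)).sup' Finset.nonempty_range_add_one s :=
    Finset.le_sup' s (Finset.self_mem_range_succ n)
  have h2 : (Finset.range (n + 1)).inf' Finset.nonempty_range_add_one s ≤ s 0 :=
    Finset.inf'_le s (Finset.mem_range.2 n.succ_pos)
  rw [spread]
  linarith

theorem spread_nonneg (s : ℕ → ℝ) (n : ℕ) : 0 ≤ spread s n := by
  have h : 0 ∈ Finset.range (n + 1) := Finset.mem_range.2 n.succ_pos
  rw [spread, sub_nonneg]
  exact (Finset.inf'_le s h).trans (Finset.le_sup' s h)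

theorem measurable_spread {α : Type*} [MeasurableSpace α] {s : ℕ → α → ℝ}
    (hs : ∀ k, Measurable (s k)) (n : ℕ) : Measurable fun a => spread (fun k => s k a) n := by
  have h1 := Finset.measurable_sup' (Finset.nonempty_range_add_one (n := n)) fun k _ => hs k
  have h2 : Measurable ((Finset.range (n + 1)).inf' Finset.nonempty_range_add_one s) :=
    Finset.inf'_induction _ _ (fun _ ha _ hb => ha.inf hb) fun k _ => hs k
  convert h1.sub h2 using 1
  funext a
  rw [Pi.sub_apply, Finset.sup'_apply, Finset.inf'_apply, spread]

theorem continuous_spread {α : Type*} [TopologicalSpace α] {s : ℕ → α → ℝ}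
    (hs : ∀ k, Continuous (s k)) (n : ℕ) : Continuous fun a => spread (fun k => s k a) n := by
  unfold spread
  exact (Continuous.finset_sup'_apply _ fun k _ => hs k).sub
    (Continuous.finset_inf'_apply _ fun k _ => hs k)

/-! ### Second moments -/

theorem eLpNorm_two_sq {α : Type*} [MeasurableSpace α] (μ : Measure α) (f : α → ℝ) :
    eLpNorm f 2 μ ^ 2 = ∫⁻ x, ‖f x‖ₑ ^ 2 ∂μ := by
  have h := eLpNorm_nnreal_pow_eq_lintegral (μ := μ) (f := f) (p := 2) two_ne_zero
  simpa using h

theorem enorm_sq_eq_ofReal (x : ℝ) : ‖x‖ₑ ^ 2 = ENNReal.ofReal (x ^ 2) := by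
  rw [Real.enorm_eq_ofReal_abs, ← ENNReal.ofReal_pow (abs_nonneg _), sq_abs]

/-- Cauchy–Schwarz against the constant 1. -/
theorem enorm_integral_sq_le {α : Type*} [MeasurableSpace α] {ν : Measure α} {f : α → ℝ}
    (hf : AEStronglyMeasurable f ν) :
    ‖∫ x, f x ∂ν‖ₑ ^ 2 ≤ ν Set.univ * ∫⁻ x, ‖f x‖ₑ ^ 2 ∂ν := by
  have h1 : ‖∫ x, f x ∂ν‖ₑ ≤ eLpNorm f 2 ν * ν Set.univ ^ (1 / 2 : ℝ) := by
    refine (enorm_integral_le_lintegral_enorm f).trans ?_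
    have h := eLpNorm_le_eLpNorm_mul_rpow_measure_univ (μ := ν) (p := 1) (q := 2) one_le_two hf
    have hexp : 1 / ENNReal.toReal 1 - 1 / ENNReal.toReal 2 = (1 / 2 : ℝ) := by norm_num
    rwa [eLpNorm_one_eq_lintegral_enorm, hexp] at h
  calc ‖∫ x, f x ∂ν‖ₑ ^ 2 ≤ (eLpNorm f 2 ν * ν Set.univ ^ (1 / 2 : ℝ)) ^ 2 := by gcongr
    _ = ν Set.univ * ∫⁻ x, ‖f x‖ₑ ^ 2 ∂ν := by
        rw [mul_pow, eLpNorm_two_sq, ← ENNReal.rpow_natCast (_ ^ (1 / 2 : ℝ)), ← ENNReal.rpow_mul]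
        norm_num [mul_comm]

theorem eLpNorm_sub_integral_le {Ω : Type*} [MeasurableSpace Ω] {P : Measure Ω}
    [IsProbabilityMeasure P] {f : Ω → ℝ} (hf : AEStronglyMeasurable f P) :
    eLpNorm (fun ω => f ω - ∫ ω', f ω' ∂P) 2 P ≤ 2 * eLpNorm f 2 P := by
  have h1 : eLpNorm (fun _ : Ω => ∫ ω', f ω' ∂P) 2 P ≤ eLpNorm f 2 P := by
    rw [eLpNorm_const _ two_ne_zero (IsProbabilityMeasure.ne_zero P), measure_univ,
      ENNReal.one_rpow, mul_one]
    refine (enorm_integral_le_lintegral_enorm f).trans ?_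
    rw [← eLpNorm_one_eq_lintegral_enorm]
    exact eLpNorm_le_eLpNorm_of_exponent_le one_le_two hf
  calc eLpNorm (fun ω => f ω - ∫ ω', f ω' ∂P) 2 P
      ≤ eLpNorm f 2 P + eLpNorm (fun _ : Ω => ∫ ω', f ω' ∂P) 2 P :=
        eLpNorm_sub_le hf aestronglyMeasurable_const one_le_two
    _ ≤ 2 * eLpNorm f 2 P := by
        rw [two_mul]
        gcongr

/-! ### The perimeter of the hull of a walk -/

section Walk

variable {Ω : Type*} {Z : ℕ → Ω → Plane} {u : Plane}

/-- The excess of the width of the walk in the direction at angle `θ` from `u` over its final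
displacement in that direction. -/
noncomputable def widthExcess (Z : ℕ → Ω → Plane) (u : Plane) (n : ℕ) (ω : Ω) (θ : ℝ) : ℝ :=
  spread (fun k => inner ℝ (walk Z k ω) (dir u θ)) n - inner ℝ (walk Z n ω) (dir u θ)

/-- The double negation puts the walk in the form that `spread_sub_le_lindley` expects. -/
theorem inner_walk (Z : ℕ → Ω → Plane) (k : ℕ) (ω : Ω) (e : Plane) :
    (inner ℝ (walk Z k ω) e : ℝ) = ∑ i ∈ Finset.range k, - -(inner ℝ (Z i ω) e : ℝ) := by
  rw [walk, sum_inner]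
  simp

theorem widthExcess_nonneg (Z : ℕ → Ω → Plane) (u : Plane) (n : ℕ) (ω : Ω) (θ : ℝ) :
    0 ≤ widthExcess Z u n ω θ := by
  rw [widthExcess, sub_nonneg]
  exact le_spread (s := fun k => inner ℝ (walk Z k ω) (dir u θ)) (by simp [walk]) n

theorem widthExcess_le (Z : ℕ → Ω → Plane) (u : Plane) (n : ℕ) (ω : Ω) (θ : ℝ) :
    widthExcess Z u n ω θ ≤ lindley (fun i => -inner ℝ (Z i ω) (dir u θ)) n
      + lindley (fun i => -inner ℝ (Z (reverseBelow n i) ω) (dir u θ)) n := by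
  rw [widthExcess]
  simp_rw [inner_walk]
  exact spread_sub_le_lindley _ n

theorem continuous_widthExcess (Z : ℕ → Ω → Plane) (u : Plane) (n : ℕ) (ω : Ω) :
    Continuous (widthExcess Z u n ω) := by
  have := continuous_dir u
  exact (continuous_spread (fun k => by fun_prop) n).sub (by fun_prop)

/-- The `perp u` component is multiplied by the odd function `sin` and drops out. -/
theorem integral_inner_dir (x u : Plane) :
    ∫ θ in halfCircle, (inner ℝ x (dir u θ) : ℝ) = 2 * inner ℝ x u := by
  have hle : -(Real.pi / 2) ≤ Real.pi / 2 := by linarith [Real.pi_pos]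
  rw [← integral_Ioc_eq_integral_Ioo, ← intervalIntegral.integral_of_le hle]
  simp_rw [inner_dir]
  rw [intervalIntegral.integral_add
      (Continuous.intervalIntegrable (by fun_prop) _ _)
      (Continuous.intervalIntegrable (by fun_prop) _ _),
    intervalIntegral.integral_mul_const, intervalIntegral.integral_mul_const, integral_cos,
    integral_sin, Real.cos_neg, Real.sin_neg, Real.sin_pi_div_two]
  ring

theorem integrable_halfCircle {f : ℝ → ℝ} (hf : Continuous f) :
    Integrable f (volume.restrict halfCircle) :=
  (hf.integrableOn_Icc (a := -(Real.pi / 2)) (b := Real.pi / 2)).mono_set Set.Ioo_subset_Icc_self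

theorem hullPerimeter_eq (Z : ℕ → Ω → Plane) (hu : ‖u‖ = 1) (n : ℕ) (ω : Ω) :
    hullPerimeter Z n ω
      = (∫ θ in halfCircle, widthExcess Z u n ω θ) + 2 * inner ℝ (walk Z n ω) u := by
  have hdc := continuous_dir u
  have hc : Continuous fun θ => spread (fun k => inner ℝ (walk Z k ω) (dir u θ)) n :=
    continuous_spread (fun k => by fun_prop) n
  have hi : Continuous fun θ => (inner ℝ (walk Z n ω) (dir u θ) : ℝ) := by fun_prop
  rw [hullPerimeter, walkHull, perimeter_convexHull_image (fun k => walk Z k ω) n hu,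
    ← integral_eq_lintegral_of_nonneg_ae (Eventually.of_forall fun θ => spread_nonneg _ _)
      hc.aestronglyMeasurable, ← integral_inner_dir]
  have h : ∫ θ in halfCircle, widthExcess Z u n ω θ
      = (∫ θ in halfCircle, spread (fun k => inner ℝ (walk Z k ω) (dir u θ)) n)
        - ∫ θ in halfCircle, (inner ℝ (walk Z n ω) (dir u θ) : ℝ) :=
    integral_sub (integrable_halfCircle hc) (integrable_halfCircle hi)
  rw [h, sub_add_cancel]

variable [MeasurableSpace Ω]

theorem measurable_walk (hm : ∀ i, Measurable (Z i)) (n : ℕ) : Measurable (walk Z n) := by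
  unfold walk
  exact Finset.measurable_fun_sum _ fun i _ => hm i

theorem measurable_widthExcess (hm : ∀ i, Measurable (Z i)) (u : Plane) (n : ℕ) :
    Measurable fun q : Ω × ℝ => widthExcess Z u n q.1 q.2 := by
  have hd : Measurable fun q : Ω × ℝ => dir u q.2 :=
    (continuous_dir u).measurable.comp measurable_snd
  have hk : ∀ k, Measurable fun q : Ω × ℝ => (inner ℝ (walk Z k q.1) (dir u q.2) : ℝ) :=
    fun k => ((measurable_walk hm k).comp measurable_fst).inner hd
  exact (measurable_spread hk n).sub (hk n)

theorem measurable_integral_widthExcess (hm : ∀ i, Measurable (Z i)) (u : Plane) (n : ℕ) :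
    Measurable fun ω => ∫ θ in halfCircle, widthExcess Z u n ω θ :=
  (StronglyMeasurable.integral_prod_right
    (measurable_widthExcess hm u n).stronglyMeasurable).measurable

variable {P : Measure Ω}

/-- Cauchy–Schwarz in the angle, over an interval of length `π`, followed by Tonelli. -/
theorem lintegral_sq_integral_widthExcess_le [SFinite P] (hm : ∀ i, Measurable (Z i))
    (u : Plane) (n : ℕ) :
    ∫⁻ ω, ‖∫ θ in halfCircle, widthExcess Z u n ω θ‖ₑ ^ 2 ∂P
      ≤ ENNReal.ofReal Real.pi
        * ∫⁻ θ in halfCircle, ∫⁻ ω, ‖widthExcess Z u n ω θ‖ₑ ^ 2 ∂P := by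
  have hsq : Measurable fun q : Ω × ℝ => ‖widthExcess Z u n q.1 q.2‖ₑ ^ 2 :=
    (measurable_widthExcess hm u n).enorm.pow_const 2
  calc ∫⁻ ω, ‖∫ θ in halfCircle, widthExcess Z u n ω θ‖ₑ ^ 2 ∂P
      ≤ ∫⁻ ω, ENNReal.ofReal Real.pi
          * (∫⁻ θ in halfCircle, ‖widthExcess Z u n ω θ‖ₑ ^ 2) ∂P := by
        refine lintegral_mono fun ω => ?_
        refine (enorm_integral_sq_le
          (continuous_widthExcess Z u n ω).aestronglyMeasurable).trans (le_of_eq ?_)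
        rw [Measure.restrict_apply_univ, Real.volume_Ioo]
        congr 2
        ring
    _ = ENNReal.ofReal Real.pi
          * ∫⁻ ω, (∫⁻ θ in halfCircle, ‖widthExcess Z u n ω θ‖ₑ ^ 2) ∂P :=
        lintegral_const_mul' _ _ ENNReal.ofReal_ne_top
    _ = _ := by
        rw [lintegral_lintegral_swap hsq.aemeasurable]

theorem lintegral_widthExcess_sq_le {n : ℕ} {θ c : ℝ} (hm : ∀ i, Measurable (Z i))
    (hL : ∀ i, MemLp (Z i) 2 P)
    (h1 : ∫ ω, lindley (fun i => -inner ℝ (Z i ω) (dir u θ)) n ^ 2 ∂P ≤ c)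
    (h2 : ∫ ω, lindley (fun i => -inner ℝ (Z (reverseBelow n i) ω) (dir u θ)) n ^ 2 ∂P ≤ c) :
    ∫⁻ ω, ‖widthExcess Z u n ω θ‖ₑ ^ 2 ∂P ≤ ENNReal.ofReal (4 * c) := by
  have hξm : ∀ i, Measurable fun ω => -(inner ℝ (Z i ω) (dir u θ) : ℝ) := fun i =>
    ((hm i).inner measurable_const).neg
  have hξL : ∀ i, MemLp (fun ω => -(inner ℝ (Z i ω) (dir u θ) : ℝ)) 2 P := fun i =>
    ((hL i).inner_const (dir u θ)).neg
  have hI1 := (memLp_lindley hξm hξL n).integrable_sq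
  have hI2 := (memLp_lindley (fun i => hξm (reverseBelow n i))
    (fun i => hξL (reverseBelow n i)) n).integrable_sq
  set W : Ω → ℝ := fun ω => lindley (fun i => -inner ℝ (Z i ω) (dir u θ)) n with hW
  set W' : Ω → ℝ := fun ω => lindley (fun i => -inner ℝ (Z (reverseBelow n i) ω) (dir u θ)) n
    with hW'
  calc ∫⁻ ω, ‖widthExcess Z u n ω θ‖ₑ ^ 2 ∂P
      ≤ ∫⁻ ω, ENNReal.ofReal (2 * W ω ^ 2 + 2 * W' ω ^ 2) ∂P := by
        refine lintegral_mono fun ω => ?_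
        rw [enorm_sq_eq_ofReal]
        apply ENNReal.ofReal_le_ofReal
        have h := pow_le_pow_left₀ (widthExcess_nonneg Z u n ω θ) (widthExcess_le Z u n ω θ) 2
        have h' : widthExcess Z u n ω θ ^ 2 ≤ (W ω + W' ω) ^ 2 := h
        nlinarith [sq_nonneg (W ω - W' ω)]
    _ = ENNReal.ofReal (∫ ω, (2 * W ω ^ 2 + 2 * W' ω ^ 2) ∂P) :=
        (ofReal_integral_eq_lintegral_ofReal ((hI1.const_mul 2).add (hI2.const_mul 2))
          (Eventually.of_forall fun ω => 
            show (0 : ℝ) ≤ 2 * W ω ^ 2 + 2 * W' ω ^ 2 by positivity)).symm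
    _ ≤ ENNReal.ofReal (4 * c) := by
        apply ENNReal.ofReal_le_ofReal
        have : ∫ ω, (2 * W ω ^ 2 + 2 * W' ω ^ 2) ∂P
            = 2 * ∫ ω, W ω ^ 2 ∂P + 2 * ∫ ω, W' ω ^ 2 ∂P := by
          rw [← integral_const_mul, ← integral_const_mul]
          exact integral_add (hI1.const_mul 2) (hI2.const_mul 2)
        rw [this]
        linarith

/-! ### The width excess for i.i.d. increments -/

section IID

theorem integral_neg_inner_dir (hint : Integrable (Z 0) P) (hu : ‖u‖ = 1)
    {d : ℝ} (hmean : ∫ ω, Z 0 ω ∂P = d • u) (θ : ℝ) :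
    ∫ ω, -(inner ℝ (Z 0 ω) (dir u θ) : ℝ) ∂P = -(d * Real.cos θ) := by
  have h : ∫ ω, (inner ℝ (Z 0 ω) (dir u θ) : ℝ) ∂P = inner ℝ (∫ ω, Z 0 ω ∂P) (dir u θ) := by
    rw [real_inner_comm, ← integral_inner hint]
    exact integral_congr_ae (Eventually.of_forall fun ω => real_inner_comm _ _)
  rw [integral_neg, h, hmean, real_inner_smul_left, inner_dir, inner_self_perp,
    real_inner_self_eq_norm_sq, hu]
  ring

theorem measurable_neg_inner (e : Plane) : Measurable fun z : Plane => -(inner ℝ z e : ℝ) :=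
  (measurable_id.inner measurable_const).neg

variable [IsProbabilityMeasure P]

/-- This linear bound is uniform in `θ`, hence provides both square integrability and the dominating
function for the limit. -/
theorem lintegral_widthExcess_sq_le_mul (hm : ∀ i, Measurable (Z i)) (hind : iIndepFun Z P)
    (hid : ∀ i, IdentDistrib (Z i) (Z 0) P P) (hL : MemLp (Z 0) 2 P) (hu : ‖u‖ = 1)
    {d : ℝ} (hd : 0 ≤ d) (hmean : ∫ ω, Z 0 ω ∂P = d • u) {θ : ℝ} (hθ : θ ∈ halfCircle) (n : ℕ) :
    ∫⁻ ω, ‖widthExcess Z u n ω θ‖ₑ ^ 2 ∂P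
      ≤ ENNReal.ofReal (4 * (n * ∫ ω, ‖Z 0 ω‖ ^ 2 ∂P)) := by
  have hLi : ∀ i, MemLp (Z i) 2 P := fun i => (hid i).symm.memLp_snd hL
  have hξm : ∀ i, Measurable fun ω => -(inner ℝ (Z i ω) (dir u θ) : ℝ) := fun i =>
    (measurable_neg_inner _).comp (hm i)
  have hξL : ∀ i, MemLp (fun ω => -(inner ℝ (Z i ω) (dir u θ) : ℝ)) 2 P := fun i =>
    ((hLi i).inner_const (dir u θ)).neg
  have hξind : iIndepFun (fun i ω => -(inner ℝ (Z i ω) (dir u θ) : ℝ)) P :=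
    hind.comp (fun _ z => -(inner ℝ z (dir u θ) : ℝ)) fun _ => measurable_neg_inner _
  have hξmean : ∀ i, ∫ ω, -(inner ℝ (Z i ω) (dir u θ) : ℝ) ∂P ≤ 0 := by
    intro i
    have h1 : ∫ ω, -(inner ℝ (Z i ω) (dir u θ) : ℝ) ∂P
        = ∫ ω, -(inner ℝ (Z 0 ω) (dir u θ) : ℝ) ∂P :=
      ((hid i).comp (measurable_neg_inner (dir u θ))).integral_eq
    rw [h1, integral_neg_inner_dir (hL.integrable one_le_two) hu hmean, neg_nonpos]
    exact mul_nonneg hd (Real.cos_pos_of_mem_Ioo hθ).le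
  have hξsq : ∀ i, ∫ ω, (-(inner ℝ (Z i ω) (dir u θ) : ℝ)) ^ 2 ∂P ≤ ∫ ω, ‖Z 0 ω‖ ^ 2 ∂P := by
    intro i
    have h1 : ∫ ω, ‖Z i ω‖ ^ 2 ∂P = ∫ ω, ‖Z 0 ω‖ ^ 2 ∂P :=
      ((hid i).comp (measurable_norm.pow_const 2)).integral_eq
    rw [← h1]
    refine integral_mono (hξL i).integrable_sq (hLi i).norm.integrable_sq fun ω => ?_
    have := abs_real_inner_le_norm (Z i ω) (dir u θ)
    rw [norm_dir hu, mul_one] at this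
    simp only [neg_sq]
    rw [← sq_abs]
    exact pow_le_pow_left₀ (abs_nonneg _) this 2
  apply lintegral_widthExcess_sq_le hm hLi
  · exact integral_lindley_sq_le hξm hξind hξL hξmean hξsq n
  · exact integral_lindley_sq_le (fun i => hξm _) (hξind.precomp (reverseBelow_injective n))
      (fun i => hξL _) (fun i => hξmean _) (fun i => hξsq _) n

/-- At a fixed angle of the open half circle the reflected walks have drift `-(d cos θ) < 0`. The
sublinear bound depends only on the law of the increments, so one constant serves both orders. -/
theorem tendsto_lintegral_widthExcess_sq (hm : ∀ i, Measurable (Z i)) (hind : iIndepFun Z P)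
    (hid : ∀ i, IdentDistrib (Z i) (Z 0) P P) (hL : MemLp (Z 0) 2 P) (hu : ‖u‖ = 1)
    {d : ℝ} (hd : 0 < d) (hmean : ∫ ω, Z 0 ω ∂P = d • u) {θ : ℝ} (hθ : θ ∈ halfCircle) :
    Tendsto (fun n : ℕ => ENNReal.ofReal (n : ℝ)⁻¹ * ∫⁻ ω, ‖widthExcess Z u n ω θ‖ₑ ^ 2 ∂P)
      atTop (𝓝 0) := by
  have hLi : ∀ i, MemLp (Z i) 2 P := fun i => (hid i).symm.memLp_snd hL
  have hg := measurable_neg_inner (dir u θ)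
  have hξm : ∀ i, Measurable fun ω => -(inner ℝ (Z i ω) (dir u θ) : ℝ) := fun i =>
    hg.comp (hm i)
  have hξind : iIndepFun (fun i ω => -(inner ℝ (Z i ω) (dir u θ) : ℝ)) P :=
    hind.comp (fun _ z => -(inner ℝ z (dir u θ) : ℝ)) fun _ => hg
  have hξid : ∀ i, IdentDistrib (fun ω => -(inner ℝ (Z i ω) (dir u θ) : ℝ))
      (fun ω => -(inner ℝ (Z 0 ω) (dir u θ) : ℝ)) P P := fun i => (hid i).comp hg
  have hmean0 : ∫ ω, -(inner ℝ (Z 0 ω) (dir u θ) : ℝ) ∂P < 0 := by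
    rw [integral_neg_inner_dir (hL.integrable one_le_two) hu hmean, neg_lt_zero]
    exact mul_pos hd (Real.cos_pos_of_mem_Ioo hθ)
  rw [ENNReal.tendsto_nhds_zero]
  intro ε hε
  obtain ⟨δ, hδ0, hδε⟩ : ∃ δ : ℝ, 0 < δ ∧ ENNReal.ofReal δ ≤ ε := by
    obtain ⟨δ, h0, h1⟩ := ENNReal.lt_iff_exists_nnreal_btwn.1 hε
    exact ⟨δ, by exact_mod_cast h0, by simpa using h1.le⟩
  -- With `δ / 8` the bound `4 (C + n δ / 8)` is `4 C + n δ / 2`, which is at most `n δ` once `n ≥ 8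
  -- C / δ`.
  obtain ⟨C, hC⟩ := exists_integral_lindley_sq_le (hξm 0)
    ((hL.inner_const (dir u θ)).neg) hmean0 (show 0 < δ / 8 by positivity)
  filter_upwards [eventually_ge_atTop ⌈8 * C / δ⌉₊, eventually_ge_atTop 1] with n hn hn1
  have hnpos : (0 : ℝ) < n := by exact_mod_cast hn1
  have hle := lintegral_widthExcess_sq_le (c := C + n * (δ / 8)) hm hLi
    (hC _ hξm hξind hξid n)
    (hC _ (fun i => hξm (reverseBelow n i)) (hξind.precomp (reverseBelow_injective n))
      (fun i => hξid _) n)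
  calc ENNReal.ofReal (n : ℝ)⁻¹ * ∫⁻ ω, ‖widthExcess Z u n ω θ‖ₑ ^ 2 ∂P
      ≤ ENNReal.ofReal (n : ℝ)⁻¹ * ENNReal.ofReal (4 * (C + n * (δ / 8))) := by gcongr
    _ = ENNReal.ofReal ((n : ℝ)⁻¹ * (4 * (C + n * (δ / 8)))) :=
        (ENNReal.ofReal_mul (by positivity)).symm
    _ ≤ ENNReal.ofReal δ := by
        apply ENNReal.ofReal_le_ofReal
        rw [inv_mul_le_iff₀ hnpos]
        have := (div_le_iff₀ hδ0).1 (Nat.ceil_le.1 hn)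
        linarith
    _ ≤ ε := hδε

theorem memLp_integral_widthExcess (hm : ∀ i, Measurable (Z i)) (hind : iIndepFun Z P)
    (hid : ∀ i, IdentDistrib (Z i) (Z 0) P P) (hL : MemLp (Z 0) 2 P) (hu : ‖u‖ = 1)
    {d : ℝ} (hd : 0 ≤ d) (hmean : ∫ ω, Z 0 ω ∂P = d • u) (n : ℕ) :
    MemLp (fun ω => ∫ θ in halfCircle, widthExcess Z u n ω θ) 2 P := by
  refine ⟨(measurable_integral_widthExcess hm u n).aestronglyMeasurable, ?_⟩
  suffices h : eLpNorm (fun ω => ∫ θ in halfCircle, widthExcess Z u n ω θ) 2 P ^ 2 < ⊤ by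
    simpa [ENNReal.pow_lt_top_iff] using h
  rw [eLpNorm_two_sq]
  refine (lintegral_sq_integral_widthExcess_le hm u n).trans_lt ?_
  refine ENNReal.mul_lt_top ENNReal.ofReal_lt_top ?_
  refine (setLIntegral_mono' measurableSet_Ioo fun θ hθ =>
    lintegral_widthExcess_sq_le_mul hm hind hid hL hu hd hmean hθ n).trans_lt ?_
  rw [setLIntegral_const]
  exact ENNReal.mul_lt_top ENNReal.ofReal_lt_top measure_Ioo_lt_top

/-- The drift degenerates as `θ` approaches `±π/2`, so no rate uniform in `θ` is sought: dominated
convergence needs only the pointwise limit and the uniform linear bound. -/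
theorem tendsto_eLpNorm_integral_widthExcess (hm : ∀ i, Measurable (Z i)) (hind : iIndepFun Z P)
    (hid : ∀ i, IdentDistrib (Z i) (Z 0) P P) (hL : MemLp (Z 0) 2 P) (hu : ‖u‖ = 1)
    {d : ℝ} (hd : 0 < d) (hmean : ∫ ω, Z 0 ω ∂P = d • u) :
    Tendsto (fun n : ℕ => ENNReal.ofReal (Real.sqrt n)⁻¹
      * eLpNorm (fun ω => ∫ θ in halfCircle, widthExcess Z u n ω θ) 2 P) atTop (𝓝 0) := by
  have hmeas : ∀ n : ℕ, Measurable fun θ =>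
      ENNReal.ofReal (n : ℝ)⁻¹ * ∫⁻ ω, ‖widthExcess Z u n ω θ‖ₑ ^ 2 ∂P := fun n =>
    (Measurable.lintegral_prod_left' ((measurable_widthExcess hm u n).enorm.pow_const 2)).const_mul _
  have hlim : Tendsto (fun n : ℕ => ∫⁻ θ in halfCircle,
      ENNReal.ofReal (n : ℝ)⁻¹ * ∫⁻ ω, ‖widthExcess Z u n ω θ‖ₑ ^ 2 ∂P) atTop (𝓝 0) := by
    have h := tendsto_lintegral_of_dominated_convergence (μ := volume.restrict halfCircle)
      (f := fun _ => 0) (fun _ => ENNReal.ofReal (4 * ∫ ω, ‖Z 0 ω‖ ^ 2 ∂P)) hmeas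
      (fun n => by
        filter_upwards [ae_restrict_mem measurableSet_Ioo] with θ hθ
        have hσ : 0 ≤ ∫ ω, ‖Z 0 ω‖ ^ 2 ∂P := integral_nonneg fun ω => sq_nonneg _
        calc ENNReal.ofReal (n : ℝ)⁻¹ * ∫⁻ ω, ‖widthExcess Z u n ω θ‖ₑ ^ 2 ∂P
            ≤ ENNReal.ofReal (n : ℝ)⁻¹ * ENNReal.ofReal (4 * (n * ∫ ω, ‖Z 0 ω‖ ^ 2 ∂P)) := by
              gcongr
              exact lintegral_widthExcess_sq_le_mul hm hind hid hL hu hd.le hmean hθ n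
          _ = ENNReal.ofReal ((n : ℝ)⁻¹ * (4 * (n * ∫ ω, ‖Z 0 ω‖ ^ 2 ∂P))) :=
              (ENNReal.ofReal_mul (by positivity)).symm
          _ ≤ ENNReal.ofReal (4 * ∫ ω, ‖Z 0 ω‖ ^ 2 ∂P) := by
              apply ENNReal.ofReal_le_ofReal
              rcases n.eq_zero_or_pos with rfl | hn
              · simpa using hσ
              · have : (n : ℝ) ≠ 0 := by positivity
                apply le_of_eq
                field_simp)
      (by
        rw [setLIntegral_const]
        exact (ENNReal.mul_lt_top ENNReal.ofReal_lt_top measure_Ioo_lt_top).ne)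
      (by
        filter_upwards [ae_restrict_mem measurableSet_Ioo] with θ hθ
        exact tendsto_lintegral_widthExcess_sq hm hind hid hL hu hd hmean hθ)
    simpa using h
  have hsq : Tendsto (fun n : ℕ => (ENNReal.ofReal (Real.sqrt n)⁻¹
      * eLpNorm (fun ω => ∫ θ in halfCircle, widthExcess Z u n ω θ) 2 P) ^ 2) atTop (𝓝 0) := by
    have h0 : Tendsto (fun n : ℕ => ENNReal.ofReal Real.pi * ∫⁻ θ in halfCircle,
        ENNReal.ofReal (n : ℝ)⁻¹ * ∫⁻ ω, ‖widthExcess Z u n ω θ‖ₑ ^ 2 ∂P) atTop (𝓝 0) := by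
      simpa using ENNReal.Tendsto.const_mul hlim (Or.inr ENNReal.ofReal_ne_top)
    refine tendsto_of_tendsto_of_tendsto_of_le_of_le tendsto_const_nhds h0
      (fun n => zero_le) fun n => ?_
    simp only
    rw [mul_pow, eLpNorm_two_sq, ← ENNReal.ofReal_pow (by positivity), inv_pow,
      Real.sq_sqrt n.cast_nonneg, lintegral_const_mul' _ _ ENNReal.ofReal_ne_top]
    calc _ ≤ ENNReal.ofReal (n : ℝ)⁻¹ * (ENNReal.ofReal Real.pi
          * ∫⁻ θ in halfCircle, ∫⁻ ω, ‖widthExcess Z u n ω θ‖ₑ ^ 2 ∂P) := by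
          gcongr
          exact lintegral_sq_integral_widthExcess_le hm u n
      _ = _ := mul_left_comm _ _ _
  -- Return from the squared norm to the norm by continuity of the square root at 0.
  have h := ((ENNReal.continuous_rpow_const (y := (1 / 2 : ℝ))).tendsto 0).comp hsq
  rw [ENNReal.zero_rpow_of_pos (by norm_num)] at h
  refine h.congr fun n => ?_
  simp only [Function.comp_apply]
  rw [← ENNReal.rpow_natCast, ← ENNReal.rpow_mul]
  norm_num

end IID

end Walk

/-! ### The main theorem -/

theorem theorem1p3 {Ω : Type*} [MeasurableSpace Ω] (P : Measure Ω) [IsProbabilityMeasure P]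
    (Z : ℕ → Ω → Plane)
    (hmeas : ∀ i, Measurable (Z i))
    (hindep : iIndepFun Z P)
    (hident : ∀ i, IdentDistrib (Z i) (Z 0) P P)
    (hsq : Integrable (fun ω => ‖Z 0 ω‖ ^ 2) P)
    (hdrift : (∫ ω, Z 0 ω ∂P) ≠ 0) :
    (∀ n, MemLp (hullPerimeter Z n) 2 P) ∧
    Tendsto
      (fun n : ℕ => eLpNorm
        (fun ω => (Real.sqrt n)⁻¹ *
          |hullPerimeter Z n ω - (∫ ω', hullPerimeter Z n ω' ∂P)
            - ∑ i ∈ Finset.range n,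
                2 * inner ℝ (Z i ω - ∫ ω', Z 0 ω' ∂P) (∫ ω', Z 0 ω' ∂P)
                  / ‖∫ ω', Z 0 ω' ∂P‖|) 2 P)
      atTop (𝓝 0) := by
  set m : Plane := ∫ ω, Z 0 ω ∂P with hm
  have hL : MemLp (Z 0) 2 P :=
    (memLp_two_iff_integrable_sq_norm (hmeas 0).aestronglyMeasurable).2 hsq
  have hLi : ∀ i, MemLp (Z i) 2 P := fun i => (hident i).symm.memLp_snd hL
  have hd : 0 < ‖m‖ := norm_pos_iff.2 hdrift
  obtain ⟨u, hu, hmu⟩ := exists_unit_smul m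
  set D : ℕ → Ω → ℝ := fun n ω => ∫ θ in halfCircle, widthExcess Z u n ω θ with hD
  have hDL : ∀ n, MemLp (D n) 2 P :=
    memLp_integral_widthExcess hmeas hindep hident hL hu hd.le hmu
  have hwalkL : ∀ n, MemLp (walk Z n) 2 P := fun n => by
    have := memLp_finsetSum (Finset.range n) (f := Z) fun i _ => hLi i
    exact this
  have hGL : ∀ n, MemLp (fun ω => 2 * (inner ℝ (walk Z n ω) u : ℝ)) 2 P := fun n =>
    ((hwalkL n).inner_const u).const_mul 2
  have hper : ∀ n, hullPerimeter Z n = fun ω => D n ω + 2 * (inner ℝ (walk Z n ω) u : ℝ) :=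
    fun n => funext fun ω => hullPerimeter_eq Z hu n ω
  refine ⟨fun n => ?_, ?_⟩
  · rw [hper]
    exact (hDL n).add (hGL n)
  have hwalk : ∀ n, ∫ ω, walk Z n ω ∂P = (n : ℝ) • m := by
    intro n
    unfold walk
    rw [integral_finsetSum _ fun i _ => (hLi i).integrable one_le_two]
    rw [Finset.sum_congr rfl fun i _ => (hident i).integral_eq, Finset.sum_const,
      Finset.card_range, Nat.cast_smul_eq_nsmul]
  -- As `m = ‖m‖ • u`, the sum subtracted is exactly the centred `2 S_n · u`; only the centred
  -- integrated excess remains.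
  have hcenter : ∀ n ω, hullPerimeter Z n ω - (∫ ω', hullPerimeter Z n ω' ∂P)
      - ∑ i ∈ Finset.range n, 2 * inner ℝ (Z i ω - m) m / ‖m‖ = D n ω - ∫ ω', D n ω' ∂P := by
    intro n ω
    have h1 : ∫ ω', hullPerimeter Z n ω' ∂P
        = ∫ ω', D n ω' ∂P + 2 * inner ℝ ((n : ℝ) • m) u := by
      have h2 : ∫ ω', (inner ℝ (walk Z n ω') u : ℝ) ∂P = inner ℝ (∫ ω', walk Z n ω' ∂P) u := by
        rw [real_inner_comm, ← integral_inner ((hwalkL n).integrable one_le_two)]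
        exact integral_congr_ae (Eventually.of_forall fun ω' => real_inner_comm _ _)
      rw [hper, integral_add ((hDL n).integrable one_le_two) ((hGL n).integrable one_le_two),
        integral_const_mul, h2, hwalk]
    have h3 : ∀ i, 2 * inner ℝ (Z i ω - m) m / ‖m‖ = 2 * (inner ℝ (Z i ω - m) u : ℝ) := by
      intro i
      have : (inner ℝ (Z i ω - m) m : ℝ) = ‖m‖ * inner ℝ (Z i ω - m) u := by
        conv_lhs => rw [show inner ℝ (Z i ω - m) m = inner ℝ (Z i ω - m) (‖m‖ • u) by rw [← hmu]]
        rw [real_inner_smul_right]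
      rw [this]
      field_simp
    have h4 : ∑ i ∈ Finset.range n, 2 * inner ℝ (Z i ω - m) m / ‖m‖
        = 2 * inner ℝ (walk Z n ω) u - 2 * inner ℝ ((n : ℝ) • m) u := by
      rw [Finset.sum_congr rfl fun i _ => h3 i, ← Finset.mul_sum, ← sum_inner,
        Finset.sum_sub_distrib, Finset.sum_const, Finset.card_range, inner_sub_left,
        Nat.cast_smul_eq_nsmul, walk]
      ring
    rw [h1, h4, hper]
    ring
  have hlim : Tendsto (fun n : ℕ => 2 * (ENNReal.ofReal (Real.sqrt n)⁻¹ * eLpNorm (D n) 2 P))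
      atTop (𝓝 0) := by
    have h := tendsto_eLpNorm_integral_widthExcess hmeas hindep hident hL hu hd hmu
    simpa using ENNReal.Tendsto.const_mul h (Or.inr ENNReal.ofNat_ne_top) (a := 2)
  refine tendsto_of_tendsto_of_tendsto_of_le_of_le tendsto_const_nhds hlim
    (fun n => zero_le) fun n => ?_
  simp only [hcenter]
  calc eLpNorm (fun ω => (Real.sqrt n)⁻¹ * |D n ω - ∫ ω', D n ω' ∂P|) 2 P
      = eLpNorm ((Real.sqrt n)⁻¹ • fun ω => D n ω - ∫ ω', D n ω' ∂P) 2 P := by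
        refine eLpNorm_congr_norm_ae (Eventually.of_forall fun ω => ?_)
        simp
    _ = ENNReal.ofReal (Real.sqrt n)⁻¹ * eLpNorm (fun ω => D n ω - ∫ ω', D n ω' ∂P) 2 P := by
        rw [eLpNorm_const_smul, Real.enorm_of_nonneg (by positivity)]
    _ ≤ ENNReal.ofReal (Real.sqrt n)⁻¹ * (2 * eLpNorm (D n) 2 P) := by
        gcongr
        -- Centring at most doubles the norm, so no estimate of the mean of `D n` is required.
        exact eLpNorm_sub_integral_le (hDL n).aestronglyMeasurable
    _ = 2 * (ENNReal.ofReal (Real.sqrt n)⁻¹ * eLpNorm (D n) 2 P) := mul_left_comm _ _ _
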